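/- Write $e(x)=e^{2\pi i x}$, $\mathbb T=\mathbb R/\mathbb Z$, let $\{x\}\in[0,1)$ be the fractional part and $\|x\|_{\mathbb T}$ the distance from $x$ to the nearest integer. Let $P(m)=b_dm^d+\dots+b_1m+b_0$ with $b_j\in\mathbb Z$ and $b_d>0$. For a function $g$ on $\mathbb Z$ and an integer $t\ge1$ let $$K_t*g(x)=\frac1t\sum_{m=1}^{t} g(x+P(m)),$$ and for $n\ge 0$ let $$\mathcal V^2_n(K_t*g)(x)=\sup_{2^n\le t_0<t_1<\dots<t_k\le 2^{n+1}}\Big(\sum_{j<k}|K_{t_j}*g(x)-K_{t_{j+1}}*g(x)|^2\Big)^{1/2}$$ be the short $2$-variation over the $n$-th dyadic block ($t_j$ and $k\ge 0$ integers). For an integer $s\ge0$ let $\mathcal R_s$ be the set of reduced fractions $a/q\in[0,1)$ with $2^s\le q<2^{s+1}$ (so $\mathcal R_0=\{0/1\}$). For $\delta>0$ define the $n$-major arcs $$\mathfrak M_n=\bigcup_{0\le s\le n\delta}\ \bigcup_{a/q\in\mathcal R_s}\mathfrak M_n(a/q),\qquad \mathfrak M_n(a/q)=\{\alpha\in\mathbb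 T: |\{b_d\alpha\}-a/q|<2^{-n(d-\delta)}\},$$ where for $a/q=0/1$ the quantity $|\{b_d\alpha\}-a/q|$ is replaced by $\|b_d\alpha\|_{\mathbb T}$. For $f\in\ell^2(\mathbb Z)$ let $\hat f(\alpha)=\sum_m f(m)e(-m\alpha)\in L^2(\mathbb T)$ and let $f_{\mathfrak M_n}(m)=\int_{\mathfrak M_n}\hat f(\alpha)e(m\alpha)\,d\alpha$ be the frequency projection of $f$ onto $\mathfrak M_n$. Then there is an absolute constant $\delta_0>0$ such that for every such polynomial $P$ and every $0<\delta<\delta_0$ there is a finite constant $C$, depending only on $P$ and $\delta$, with $$\sum_{n\ge0}\big\|\mathcal V^2_n(K_t*f_{\mathfrak M_n})\big\|_{\ell^2(\mathbb Z)}^2\le C\,\|f\|_{\ell^2(\mathbb Z)}^2\qquad\text{for all } f\in\ell^2(\mathbb Z).$$ -/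

import Mathlib

open scoped ENNReal NNReal Polynomial

namespace PolyVariation

/-- The space `ℓ²(ℤ)` of square-summable complex-valued functions on the integers. -/
abbrev EllTwo : Type := lp (fun _ : ℤ => ℂ) 2

/-- The space `L²(𝕋)`, where `𝕋 = ℝ/ℤ` carries its Lebesgue (Haar) probability measure. -/
abbrev CircleLTwo : Type :=
  MeasureTheory.Lp ℂ 2 (AddCircle.haarAddCircle : MeasureTheory.Measure UnitAddCircle)

/-- The Fourier transform `f̂(α) = ∑ₘ f(m) e(-mα)` of `f ∈ ℓ²(ℤ)`; the series converges
unconditionally in `L²(𝕋)`, see `hasSum_latticeFourier`. -/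
noncomputable def latticeFourier (f : EllTwo) : CircleLTwo :=
  ∑' m : ℤ, f m • fourierLp (T := (1 : ℝ)) 2 (-m)

theorem hasSum_latticeFourier (f : EllTwo) :
    HasSum (fun m : ℤ => f m • fourierLp (T := (1 : ℝ)) 2 (-m)) (latticeFourier f) := by
  have hmem : Memℓp (fun m : ℤ => f (-m)) 2 := by
    have h := lp.memℓp f
    rw [memℓp_gen_iff (by norm_num)] at h ⊢
    exact (Equiv.neg ℤ).summable_iff.mpr h
  have h := (fourierBasis (T := (1 : ℝ))).hasSum_repr_symm
    (⟨fun m : ℤ => f (-m), hmem⟩ : EllTwo)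
  have h2 := (Equiv.neg ℤ).hasSum_iff.mpr h
  refine Summable.hasSum ⟨_, h2.congr_fun ?_⟩
  intro m
  simp [Function.comp]

/-- The frequency projection `f_D = (f̂ · 1_D)^∨` of `f` onto `D ⊆ 𝕋`, that is
`f_D(m) = ∫_D f̂(α) e(mα) dα`. -/
noncomputable def freqProj (D : Set UnitAddCircle) (f : EllTwo) (m : ℤ) : ℂ :=
  ∫ α in D, (fourier m α : ℂ) * latticeFourier f α ∂AddCircle.haarAddCircle

/-- The fractional part `{θ} ∈ [0, 1)` of a point `θ` of `𝕋 = ℝ/ℤ`. -/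
noncomputable def circleFract (θ : UnitAddCircle) : ℝ :=
  (AddCircle.equivIco 1 0 θ : ℝ)

theorem circleFract_coe (x : ℝ) : circleFract (x : UnitAddCircle) = Int.fract x := by
  simp [circleFract, AddCircle.coe_equivIco_mk_apply]

/-- `R_s`: the rationals `a/q ∈ [0, 1)` in lowest terms with `2^s ≤ q < 2^(s+1)`.
In particular `R_0 = {0}`. -/
def rationalLevel (s : ℕ) : Set ℚ :=
  {r | 0 ≤ r ∧ r < 1 ∧ 2 ^ s ≤ r.den ∧ r.den < 2 ^ (s + 1)}

/-- The single `n`-major arc at `r = a/q`: the `α` with `|{b_d α} - a/q| < 2^{-n(d-δ)}`, where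
`d` is the degree and `b_d` the leading coefficient of `P`. At `r = 0` the distance is taken on
the circle (`‖θ‖` is the distance from `θ` to the nearest integer). -/
noncomputable def majorArcAt (P : ℤ[X]) (δ : ℝ) (n : ℕ) (r : ℚ) : Set UnitAddCircle :=
  {α | (if r = 0 then ‖P.leadingCoeff • α‖ else |circleFract (P.leadingCoeff • α) - (r : ℝ)|)
    < (2 : ℝ) ^ (-((n : ℝ) * ((P.natDegree : ℝ) - δ)))}

/-- The `n`-major arcs: the union of the arcs at `a/q ∈ R_s` over all integers
`0 ≤ s ≤ nδ`. -/
noncomputable def majorArcs (P : ℤ[X]) (δ : ℝ) (n : ℕ) : Set UnitAddCircle :=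
  ⋃ (s : ℕ) (_ : (s : ℝ) ≤ (n : ℝ) * δ) (r : ℚ) (_ : r ∈ rationalLevel s), majorArcAt P δ n r

/-- The polynomial mean `K_t * g (x) = (1/t) ∑_{m = 1}^t g(x + P(m))`. -/
noncomputable def polyMean (P : ℤ[X]) (t : ℕ) (g : ℤ → ℂ) (x : ℤ) : ℂ :=
  (1 / (t : ℂ)) * ∑ m ∈ Finset.Icc 1 t, g (x + P.eval (m : ℤ))

/-- The `r`-variation `𝒱^r(a_t : t ∈ I)`: the supremum over all finite increasing sequences
`u_0 < ⋯ < u_K` in `I` of `(∑_k |a_{u_k} - a_{u_{k+1}}|^r)^{1/r}`. -/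
noncomputable def variation (r : ℝ) (I : Set ℕ) (a : ℕ → ℂ) : ℝ≥0∞ :=
  ⨆ (K : ℕ) (u : Fin (K + 1) → ℕ) (_ : StrictMono u ∧ ∀ k, u k ∈ I),
    (∑ k : Fin K, ‖a (u k.castSucc) - a (u k.succ)‖ₑ ^ r) ^ (1 / r)

/-- The short `2`-variation `𝒱²_n(K_t * g)(x) = 𝒱²(K_t * g (x) : 2^n ≤ t ≤ 2^(n+1))`. -/
noncomputable def shortVariation (P : ℤ[X]) (n : ℕ) (g : ℤ → ℂ) (x : ℤ) : ℝ≥0∞ :=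
  variation 2 (Set.Icc (2 ^ n) (2 ^ (n + 1))) (fun t => polyMean P t g x)

/-- The squared `ℓ²(ℤ)` norm of a `[0, ∞]`-valued function. -/
noncomputable def ellTwoNormSq (V : ℤ → ℝ≥0∞) : ℝ≥0∞ := ∑' x : ℤ, V x ^ 2

end PolyVariation

/-!
A variation over a dyadic block is controlled by the square function along dyadic subdivisions of
the block, so by Plancherel it suffices to bound, uniformly in `α`, the sum over those `n` with `α`
in the `n`-major arcs of the dyadic energies of the multipliers `t ↦ (1 / t) ∑_{m ≤ t} e(P(m) α)`.

Near `b_d α ≡ a / q` such a multiplier is, up to a power-saving error, the complete Gauss mean at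
the corresponding rational point times the mean of `e(P(m) η)` at the remaining small frequency `η`.
The Gauss mean decays like a power of `q` by Weyl differencing. The energy of the second factor
decays on both sides of the critical scale `|η| 2^{nd} ≈ 1`: for small `η` the phase is nearly
constant, and for large `η` the means are small. Hence the scales `n` belonging to a fixed fraction
sum geometrically. Distinct fractions of one level are so far apart that only one of them can be
near `b_d α`, so what remains is a sum over the levels, which converges by the Gauss decay.
-/

namespace PolyVariation

open Finset Filter Topology
open scoped FourierTransform

/-! ### The dyadic square function and the short variation -/

theorem geomSum_le_inv_one_sub {r : ℝ} (h0 : 0 ≤ r) (h1 : r < 1) (n : ℕ) :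
    ∑ i ∈ range n, r ^ i ≤ (1 - r)⁻¹ :=
  ((summable_geometric_of_lt_one h0 h1).sum_le_tsum _ fun _ _ => by positivity).trans_eq
    (tsum_geometric_of_lt_one h0 h1)

section DyadicEnergy

variable {E : Type*} [SeminormedAddCommGroup E]

theorem norm_add_sq_le_two_mul (x y : E) : ‖x + y‖ ^ 2 ≤ 2 * ‖x‖ ^ 2 + 2 * ‖y‖ ^ 2 :=
  calc ‖x + y‖ ^ 2 ≤ (‖x‖ + ‖y‖) ^ 2 := by gcongr; exact norm_add_le x y
    _ ≤ 2 * (‖x‖ ^ 2 + ‖y‖ ^ 2) := add_sq_le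
    _ = _ := by ring

theorem norm_sub_sq_le_two_mul (x y : E) : ‖x - y‖ ^ 2 ≤ 2 * ‖x‖ ^ 2 + 2 * ‖y‖ ^ 2 := by
  simpa [sub_eq_add_neg] using norm_add_sq_le_two_mul x (-y)

/-- The increment of `a` from the parent of the `j`-th point of the `l`-th dyadic grid
`2 ^ n + 2 ^ (n - l) * ℕ` to that point; it vanishes for even `j`. -/
def dyadicIncrement (n : ℕ) (a : ℕ → E) (l j : ℕ) : E :=
  a (2 ^ n + 2 ^ (n - l) * j) - a (2 ^ n + 2 ^ (n - l) * (2 * (j / 2)))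

/-- The square function of `a` on `[2 ^ n, 2 ^ (n + 1)]` along the dyadic grids. It dominates the
squared short `2`-variation because the weights `(6 / 5) ^ l` grow; any ratio in `(1, √2)` would
do, the upper limit being needed in `dyadicEnergy_le`. -/
noncomputable def dyadicEnergy (n : ℕ) (a : ℕ → E) : ℝ :=
  ∑ l ∈ range (n + 1), (6 / 5) ^ l * ∑ j ∈ range (2 ^ l + 1), ‖dyadicIncrement n a l j‖ ^ 2

theorem dyadicEnergy_nonneg (n : ℕ) (a : ℕ → E) : 0 ≤ dyadicEnergy n a :=
  sum_nonneg fun _ _ => by positivity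

theorem sum_dyadicIncrement (n : ℕ) (a : ℕ → E) {r : ℕ} (hr : r ≤ 2 ^ n) :
    ∑ l ∈ range (n + 1), dyadicIncrement n a l (r / 2 ^ (n - l)) = a (2 ^ n + r) - a (2 ^ n) := by
  have increment_eq : ∀ i ∈ range (n + 1),
      dyadicIncrement n a (n + 1 - 1 - i) (r / 2 ^ (n - (n + 1 - 1 - i))) =
        a (2 ^ n + 2 ^ i * (r / 2 ^ i)) - a (2 ^ n + 2 ^ (i + 1) * (r / 2 ^ (i + 1))) := by
    intro i hi
    have hni : n - (n + 1 - 1 - i) = i := by have := mem_range.1 hi; omega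
    rw [dyadicIncrement, hni, Nat.div_div_eq_div_mul, ← pow_succ, ← mul_assoc, ← pow_succ]
  have hdiv : r / 2 ^ (n + 1) = 0 := by
    refine Nat.div_eq_of_lt (hr.trans_lt ?_)
    gcongr <;> omega
  rw [← sum_range_reflect, sum_congr rfl increment_eq, sum_range_sub']
  simp [hdiv]

theorem sum_sq_norm_sub_le_of_monotone (F : ℕ → E) {v : ℕ → ℕ} (hv : Monotone v) (K : ℕ) :
    ∑ k ∈ range K, ‖F (v (k + 1)) - F (v k)‖ ^ 2 ≤ 4 * ∑ j ∈ range (v K + 1), ‖F j‖ ^ 2 := by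
  suffices h : ∑ k ∈ range K, ‖F (v (k + 1)) - F (v k)‖ ^ 2 ≤
      4 * ∑ j ∈ range (v K), ‖F j‖ ^ 2 + 2 * ‖F (v K)‖ ^ 2 by
    rw [sum_range_succ]
    linarith [sq_nonneg ‖F (v K)‖]
  induction K with
  | zero => rw [range_zero, sum_empty]; positivity
  | succ K ih =>
    rw [sum_range_succ]
    rcases (hv K.le_succ).eq_or_lt with heq | hlt
    · rw [← Nat.succ_eq_add_one, ← heq]
      simpa using ih
    · have hmono : ∑ j ∈ range (v K + 1), ‖F j‖ ^ 2 ≤ ∑ j ∈ range (v (K + 1)), ‖F j‖ ^ 2 :=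
        sum_le_sum_of_subset_of_nonneg (range_mono hlt) fun _ _ _ => sq_nonneg _
      rw [sum_range_succ] at hmono
      linarith [norm_sub_sq_le_two_mul (F (v (K + 1))) (F (v K))]

theorem sq_norm_sum_le_geometric_weights (n : ℕ) (x : ℕ → E) :
    ‖∑ l ∈ range n, x l‖ ^ 2 ≤ 6 * ∑ l ∈ range n, (6 / 5) ^ l * ‖x l‖ ^ 2 := by
  calc ‖∑ l ∈ range n, x l‖ ^ 2 ≤ (∑ l ∈ range n, ‖x l‖) ^ 2 := by gcongr; exact norm_sum_le _ _
    _ ≤ (∑ l ∈ range n, (5 / 6) ^ l) * ∑ l ∈ range n, (6 / 5) ^ l * ‖x l‖ ^ 2 :=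
      sum_sq_le_sum_mul_sum_of_sq_le_mul _ (fun _ _ => by positivity) (fun _ _ => by positivity)
        fun l _ => by rw [← mul_assoc, ← mul_pow]; norm_num
    _ ≤ 6 * ∑ l ∈ range n, (6 / 5) ^ l * ‖x l‖ ^ 2 := by
      gcongr
      exact (geomSum_le_inv_one_sub (by norm_num) (by norm_num) n).trans_eq (by norm_num)

theorem sum_sq_norm_dyadicIncrement_sub_le (n : ℕ) (a : ℕ → E) {r : ℕ → ℕ} (hr : Monotone r)
    (hr' : ∀ k, r k ≤ 2 ^ n) {l : ℕ} (hl : l ≤ n) (K : ℕ) :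
    ∑ k ∈ range K, ‖dyadicIncrement n a l (r (k + 1) / 2 ^ (n - l)) -
        dyadicIncrement n a l (r k / 2 ^ (n - l))‖ ^ 2 ≤
      4 * ∑ j ∈ range (2 ^ l + 1), ‖dyadicIncrement n a l j‖ ^ 2 := by
  have hv : Monotone fun k => r k / 2 ^ (n - l) := fun i j hij => Nat.div_le_div_right (hr hij)
  have hvK : r K / 2 ^ (n - l) ≤ 2 ^ l := by
    refine Nat.div_le_of_le_mul ((hr' K).trans_eq ?_)
    rw [← pow_add, Nat.sub_add_cancel hl]
  refine (sum_sq_norm_sub_le_of_monotone (dyadicIncrement n a l) hv K).trans ?_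
  gcongr

theorem sum_sq_norm_sub_le_dyadicEnergy (n : ℕ) (a : ℕ → E) {u : ℕ → ℕ} (hu : Monotone u)
    (hmem : ∀ k, u k ∈ Set.Icc (2 ^ n) (2 ^ (n + 1))) (K : ℕ) :
    ∑ k ∈ range K, ‖a (u k) - a (u (k + 1))‖ ^ 2 ≤ 24 * dyadicEnergy n a := by
  obtain ⟨r, hr⟩ : ∃ r : ℕ → ℕ, ∀ k, u k = 2 ^ n + r k :=
    ⟨fun k => u k - 2 ^ n, fun k => (Nat.add_sub_cancel' (hmem k).1).symm⟩
  have hr_mono : Monotone r := fun i j hij => by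
    have := hu hij; rw [hr, hr] at this; omega
  have hr_le : ∀ k, r k ≤ 2 ^ n := fun k => by
    have := (hmem k).2; rw [hr, pow_succ] at this; omega
  let D : ℕ → ℕ → E := fun l k => dyadicIncrement n a l (r k / 2 ^ (n - l))
  have increment_le : ∀ k, ‖a (u k) - a (u (k + 1))‖ ^ 2 ≤
      6 * ∑ l ∈ range (n + 1), (6 / 5 : ℝ) ^ l * ‖D l (k + 1) - D l k‖ ^ 2 := fun k => by
    refine le_trans (le_of_eq ?_) (sq_norm_sum_le_geometric_weights (n + 1) _)
    rw [sum_sub_distrib, sum_dyadicIncrement n a (hr_le _), sum_dyadicIncrement n a (hr_le _),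
      sub_sub_sub_cancel_right, norm_sub_rev, hr, hr]
  calc ∑ k ∈ range K, ‖a (u k) - a (u (k + 1))‖ ^ 2
      ≤ ∑ k ∈ range K, 6 * ∑ l ∈ range (n + 1), (6 / 5 : ℝ) ^ l * ‖D l (k + 1) - D l k‖ ^ 2 :=
        sum_le_sum fun k _ => increment_le k
    _ = 6 * ∑ l ∈ range (n + 1), (6 / 5 : ℝ) ^ l * ∑ k ∈ range K, ‖D l (k + 1) - D l k‖ ^ 2 := by
        rw [← mul_sum, sum_comm]
        simp_rw [mul_sum]
    _ ≤ 6 * ∑ l ∈ range (n + 1), (6 / 5 : ℝ) ^ l *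
          (4 * ∑ j ∈ range (2 ^ l + 1), ‖dyadicIncrement n a l j‖ ^ 2) := by
        gcongr with l hl
        exact sum_sq_norm_dyadicIncrement_sub_le n a hr_mono hr_le
          (Nat.lt_succ_iff.1 (mem_range.1 hl)) K
    _ = 24 * dyadicEnergy n a := by
        simp_rw [dyadicEnergy, mul_left_comm _ (4 : ℝ), ← mul_sum]
        ring

theorem dyadicEnergy_add_le (n : ℕ) (a b : ℕ → E) :
    dyadicEnergy n (fun t => a t + b t) ≤ 2 * dyadicEnergy n a + 2 * dyadicEnergy n b := by
  simp only [dyadicEnergy, mul_sum, ← sum_add_distrib]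
  refine sum_le_sum fun l _ => sum_le_sum fun j _ => ?_
  have hadd : dyadicIncrement n (fun t => a t + b t) l j =
      dyadicIncrement n a l j + dyadicIncrement n b l j := add_sub_add_comm _ _ _ _
  calc (6 / 5 : ℝ) ^ l * ‖dyadicIncrement n (fun t => a t + b t) l j‖ ^ 2
      ≤ (6 / 5) ^ l * (2 * ‖dyadicIncrement n a l j‖ ^ 2 + 2 * ‖dyadicIncrement n b l j‖ ^ 2) := by
        rw [hadd]; gcongr; exact norm_add_sq_le_two_mul _ _
    _ = _ := by ring

theorem dyadicEnergy_smul {𝕜 : Type*} [NormedField 𝕜] [NormedSpace 𝕜 E] (n : ℕ) (c : 𝕜)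
    (a : ℕ → E) : dyadicEnergy n (fun t => c • a t) = ‖c‖ ^ 2 * dyadicEnergy n a := by
  simp only [dyadicEnergy, dyadicIncrement, mul_sum, ← smul_sub, norm_smul, mul_pow]
  exact sum_congr rfl fun l _ => sum_congr rfl fun j _ => by ring

theorem add_mul_mem_Icc_two_pow {n l j : ℕ} (hl : l ≤ n) (hj : j ≤ 2 ^ l) :
    2 ^ n + 2 ^ (n - l) * j ∈ Set.Icc (2 ^ n) (2 ^ (n + 1)) := by
  have h : 2 ^ (n - l) * j ≤ 2 ^ (n - l) * 2 ^ l := Nat.mul_le_mul_left _ hj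
  rw [← pow_add, Nat.sub_add_cancel hl] at h
  exact ⟨Nat.le_add_right _ _, by rw [pow_succ]; omega⟩

theorem norm_dyadicIncrement_le {n l j : ℕ} {a : ℕ → E} {K Y : ℝ} (hK : 0 ≤ K)
    (hlip : ∀ t ∈ Set.Icc (2 ^ n) (2 ^ (n + 1)), ∀ t' ∈ Set.Icc (2 ^ n) (2 ^ (n + 1)),
      ‖a t - a t'‖ ≤ K * (|(t : ℝ) - t'| / 2 ^ n))
    (hsup : ∀ t ∈ Set.Icc (2 ^ n) (2 ^ (n + 1)), ∀ t' ∈ Set.Icc (2 ^ n) (2 ^ (n + 1)),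
      ‖a t - a t'‖ ≤ K * Y) (hl : l ≤ n) (hj : j ≤ 2 ^ l) :
    ‖dyadicIncrement n a l j‖ ≤ K * min Y ((1 / 2) ^ l) := by
  have hmem := add_mul_mem_Icc_two_pow hl hj
  have hmem' : 2 ^ n + 2 ^ (n - l) * (2 * (j / 2)) ∈ Set.Icc (2 ^ n) (2 ^ (n + 1)) :=
    add_mul_mem_Icc_two_pow hl (by omega)
  rw [mul_min_of_nonneg _ _ hK]
  refine le_min (hsup _ hmem _ hmem') ((hlip _ hmem _ hmem').trans ?_)
  have hparity : |(j : ℝ) - (2 * (j / 2) : ℕ)| ≤ 1 := by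
    rw [abs_le, neg_le_sub_iff_le_add, sub_le_iff_le_add']
    constructor <;> norm_cast <;> omega
  have hscale : (2 : ℝ) ^ n = 2 ^ (n - l) * 2 ^ l := by rw [← pow_add, Nat.sub_add_cancel hl]
  gcongr
  calc |((2 ^ n + 2 ^ (n - l) * j : ℕ) : ℝ) - (2 ^ n + 2 ^ (n - l) * (2 * (j / 2)) : ℕ)| / 2 ^ n
      = 2 ^ (n - l) * |(j : ℝ) - (2 * (j / 2) : ℕ)| / 2 ^ n := by
        rw [← abs_of_pos (by positivity : (0 : ℝ) < 2 ^ (n - l)), ← abs_mul]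
        push_cast
        ring_nf
    _ ≤ 2 ^ (n - l) * 1 / 2 ^ n := by gcongr
    _ = (1 / 2) ^ l := by rw [hscale, one_div_pow]; field_simp

theorem min_sq_le_sqrt_mul {x y : ℝ} (hx : 0 ≤ x) (hy : 0 ≤ y) :
    min x y ^ 2 ≤ √x * √y * y :=
  calc min x y ^ 2 = √(min x y) * √(min x y) * min x y := by
        rw [Real.mul_self_sqrt (le_min hx hy), sq]
    _ ≤ √x * √y * y := by gcongr <;> simp

theorem dyadicEnergy_le {n : ℕ} {a : ℕ → E} {K Y : ℝ} (hK : 0 ≤ K) (hY : 0 ≤ Y)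
    (hlip : ∀ t ∈ Set.Icc (2 ^ n) (2 ^ (n + 1)), ∀ t' ∈ Set.Icc (2 ^ n) (2 ^ (n + 1)),
      ‖a t - a t'‖ ≤ K * (|(t : ℝ) - t'| / 2 ^ n))
    (hsup : ∀ t ∈ Set.Icc (2 ^ n) (2 ^ (n + 1)), ∀ t' ∈ Set.Icc (2 ^ n) (2 ^ (n + 1)),
      ‖a t - a t'‖ ≤ K * Y) :
    dyadicEnergy n a ≤ 14 * K ^ 2 * √Y := by
  have level_le : ∀ l ∈ range (n + 1), (6 / 5) ^ l * ∑ j ∈ range (2 ^ l + 1),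
      ‖dyadicIncrement n a l j‖ ^ 2 ≤ 2 * K ^ 2 * √Y * (6 / 7) ^ l := fun l hl => by
    have hsqrt : √((1 / 2) ^ l) ≤ (5 / 7) ^ l := by
      refine Real.sqrt_le_iff.2 ⟨by positivity, ?_⟩
      rw [← pow_mul, mul_comm, pow_mul]
      gcongr
      norm_num
    calc (6 / 5) ^ l * ∑ j ∈ range (2 ^ l + 1), ‖dyadicIncrement n a l j‖ ^ 2
        ≤ (6 / 5) ^ l * ∑ j ∈ range (2 ^ l + 1), (K * min Y ((1 / 2) ^ l)) ^ 2 := by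
          gcongr with j hj
          exact norm_dyadicIncrement_le hK hlip hsup (by grind) (by grind)
      _ = (6 / 5) ^ l * ((2 ^ l + 1) * (K ^ 2 * min Y ((1 / 2) ^ l) ^ 2)) := by simp [mul_pow]
      _ ≤ (6 / 5) ^ l * (2 * 2 ^ l * (K ^ 2 * (√Y * (5 / 7) ^ l * (1 / 2) ^ l))) := by
          have : (1 : ℝ) ≤ 2 ^ l := one_le_pow₀ one_le_two
          gcongr
          · linarith
          · exact (min_sq_le_sqrt_mul hY (by positivity)).trans (by gcongr)
      _ = 2 * K ^ 2 * √Y * (6 / 5 * (5 / 7) * (2 * (1 / 2))) ^ l := by simp only [mul_pow]; ring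
      _ = 2 * K ^ 2 * √Y * (6 / 7) ^ l := by norm_num
  calc dyadicEnergy n a ≤ ∑ l ∈ range (n + 1), 2 * K ^ 2 * √Y * (6 / 7) ^ l :=
        sum_le_sum level_le
    _ = 2 * K ^ 2 * √Y * ∑ l ∈ range (n + 1), (6 / 7) ^ l := by rw [mul_sum]
    _ ≤ 2 * K ^ 2 * √Y * (1 - 6 / 7)⁻¹ := by
        gcongr
        exact geomSum_le_inv_one_sub (by norm_num) (by norm_num) _
    _ = 14 * K ^ 2 * √Y := by ring

end DyadicEnergy

theorem variation_two_sq_le_dyadicEnergy (n : ℕ) (a : ℕ → ℂ) :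
    variation 2 (Set.Icc (2 ^ n) (2 ^ (n + 1))) a ^ 2 ≤
      ENNReal.ofReal (24 * dyadicEnergy n a) := by
  suffices h : variation 2 (Set.Icc (2 ^ n) (2 ^ (n + 1))) a ≤
      ENNReal.ofReal (24 * dyadicEnergy n a) ^ (1 / 2 : ℝ) by
    calc _ ≤ (ENNReal.ofReal (24 * dyadicEnergy n a) ^ (1 / 2 : ℝ)) ^ 2 := by gcongr
      _ = _ := by rw [← ENNReal.rpow_mul_natCast]; norm_num
  refine iSup_le fun K => iSup_le fun u => iSup_le fun ⟨hu, hmem⟩ => ?_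
  let v : ℕ → ℕ := fun k => u ⟨min k K, by omega⟩
  have hv : Monotone v := fun i j hij => hu.monotone (by rw [Fin.mk_le_mk]; omega)
  have hcast (k : Fin K) : v k = u k.castSucc :=
    congrArg u (Fin.ext (min_eq_left k.2.le))
  have hsucc (k : Fin K) : v (k + 1) = u k.succ := congrArg u (Fin.ext (min_eq_left k.2))
  refine ENNReal.rpow_le_rpow ?_ (by norm_num)
  calc ∑ k : Fin K, ‖a (u k.castSucc) - a (u k.succ)‖ₑ ^ (2 : ℝ)
      = ENNReal.ofReal (∑ k ∈ range K, ‖a (v k) - a (v (k + 1))‖ ^ 2) := by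
        rw [sum_range, ENNReal.ofReal_sum_of_nonneg fun _ _ => by positivity]
        refine sum_congr rfl fun k _ => ?_
        rw [hcast, hsucc, ENNReal.ofReal_pow (norm_nonneg _), ofReal_norm, ENNReal.rpow_two]
    _ ≤ ENNReal.ofReal (24 * dyadicEnergy n a) := by
        gcongr
        exact sum_sq_norm_sub_le_dyadicEnergy n a hv (fun k => hmem _) K

/-! ### Weyl differencing for complete exponential sums -/

section CompleteSums

theorem addOrderOf_le_mul_addOrderOf_nsmul {A : Type*} [AddMonoid A] {n : ℕ} (hn : 0 < n) (x : A) :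
    addOrderOf x ≤ n * addOrderOf (n • x) :=
  calc addOrderOf x = (addOrderOf x).gcd n * addOrderOf (n • x) := by
        rw [addOrderOf_nsmul' x hn.ne', Nat.mul_div_cancel' (Nat.gcd_dvd_left _ _)]
    _ ≤ n * addOrderOf (n • x) := Nat.mul_le_mul_right _ (Nat.gcd_le_right _ hn)

theorem natDegree_taylor_sub_self_le {R : Type*} [CommRing R] {F : R[X]} {d : ℕ}
    (hF : F.natDegree ≤ d + 1) (h : R) : (Polynomial.taylor h F - F).natDegree ≤ d := by
  rw [Polynomial.natDegree_le_iff_coeff_eq_zero]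
  intro k hk
  have hdeg : (Polynomial.hasseDeriv k F).natDegree ≤ 0 :=
    (Polynomial.natDegree_hasseDeriv_le F k).trans (by omega)
  rw [Polynomial.coeff_sub, Polynomial.taylor_coeff,
    Polynomial.eq_C_of_natDegree_le_zero hdeg, Polynomial.hasseDeriv_coeff]
  simp

theorem coeff_taylor_sub_self {R : Type*} [CommRing R] {F : R[X]} {d : ℕ}
    (hF : F.natDegree ≤ d + 1) (h : R) :
    (Polynomial.taylor h F - F).coeff d = (d + 1) • (h * F.coeff (d + 1)) := by
  have hdeg : (Polynomial.hasseDeriv d F).natDegree < 2 :=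
    (Polynomial.natDegree_hasseDeriv_le F d).trans_lt (by omega)
  rw [Polynomial.coeff_sub, Polynomial.taylor_coeff, Polynomial.eval_eq_sum_range' hdeg]
  simp only [sum_range_succ, range_zero, sum_empty, Polynomial.hasseDeriv_coeff, add_comm 1 d,
    nsmul_eq_mul, zero_add, Nat.choose_self, Nat.choose_succ_self_right]
  push_cast
  ring

variable {N : ℕ} [NeZero N]

theorem card_filter_mul_eq_zero_mul_addOrderOf (y : ZMod N) :
    #{h : ZMod N | h * y = 0} * addOrderOf y = N := by
  let φ : ZMod N →+ ZMod N := AddMonoidHom.mulRight y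
  have hrange : φ.range = AddSubgroup.zmultiples y := by
    ext z
    exact ⟨fun ⟨x, hx⟩ => ⟨x.val, by simpa [φ] using hx⟩, fun ⟨k, hk⟩ => ⟨k, by simpa [φ] using hk⟩⟩
  have hker : Nat.card φ.ker = #{h : ZMod N | h * y = 0} := by
    rw [Nat.card_eq_fintype_card, ← Fintype.card_subtype]
    exact Fintype.card_congr (Equiv.subtypeEquivRight fun x => by simp [φ])
  have hcard := AddSubgroup.card_mul_index φ.ker
  rwa [AddSubgroup.index_ker, hrange, Nat.card_zmultiples, hker, Nat.card_zmod] at hcard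

theorem card_filter_addOrderOf_mul_le (c : ZMod N) (T : ℕ) :
    #{h : ZMod N | addOrderOf (h * c) ≤ T} * addOrderOf c ≤ N * T ^ 2 := by
  have hsub : ({h | addOrderOf (h * c) ≤ T} : Finset (ZMod N)) ⊆
      (Icc 1 T).biUnion fun g => ({h | h * (g • c) = 0} : Finset (ZMod N)) := by
    intro h hh
    simp only [mem_filter, mem_univ, true_and, mem_biUnion, mem_Icc] at hh ⊢
    exact ⟨addOrderOf (h * c), ⟨addOrderOf_pos _, hh⟩,
      by rw [mul_smul_comm, addOrderOf_nsmul_eq_zero]⟩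
  have card_le : ∀ g ∈ Icc 1 T, #{h : ZMod N | h * (g • c) = 0} * addOrderOf c ≤ N * T := by
    intro g hg
    rw [mem_Icc] at hg
    calc #{h : ZMod N | h * (g • c) = 0} * addOrderOf c
        ≤ #{h : ZMod N | h * (g • c) = 0} * (g * addOrderOf (g • c)) := by
          gcongr; exact addOrderOf_le_mul_addOrderOf_nsmul hg.1 c
      _ = N * g := by rw [mul_left_comm, card_filter_mul_eq_zero_mul_addOrderOf, mul_comm]
      _ ≤ N * T := by gcongr; exact hg.2
  calc #{h : ZMod N | addOrderOf (h * c) ≤ T} * addOrderOf c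
      ≤ (∑ g ∈ Icc 1 T, #{h : ZMod N | h * (g • c) = 0}) * addOrderOf c := by
        gcongr; exact (card_le_card hsub).trans card_biUnion_le
    _ ≤ ∑ _ ∈ Icc 1 T, N * T := by rw [sum_mul]; exact sum_le_sum card_le
    _ = N * T ^ 2 := by rw [sum_const, Nat.card_Icc, smul_eq_mul, add_tsub_cancel_right]; ring

theorem card_filter_addOrderOf_mul_le_rpow (c : ZMod N) :
    (#{h : ZMod N | addOrderOf (h * c) ≤ ⌊(addOrderOf c : ℝ) ^ (1 / 3 : ℝ)⌋₊} : ℝ) ≤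
      N * (addOrderOf c : ℝ) ^ (-(1 / 3) : ℝ) := by
  set q : ℝ := (addOrderOf c : ℝ) with hq
  have hq0 : 0 < q := by rw [hq]; exact_mod_cast addOrderOf_pos c
  refine le_of_mul_le_mul_right ?_ hq0
  calc _ ≤ (N : ℝ) * (⌊q ^ (1 / 3 : ℝ)⌋₊ : ℝ) ^ 2 := by
        rw [hq]; exact_mod_cast card_filter_addOrderOf_mul_le c _
    _ ≤ N * (q ^ (1 / 3 : ℝ)) ^ 2 := by gcongr; exact Nat.floor_le (by positivity)
    _ = N * q ^ (-(1 / 3) : ℝ) * q := by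
        rw [mul_assoc, ← Real.rpow_add_one hq0.ne', ← Real.rpow_mul_natCast hq0.le]
        norm_num

/-- The complete exponential sum `∑ₓ e(F(x) / N)` over `x ∈ ℤ / N`. -/
noncomputable def completeSum (F : (ZMod N)[X]) : ℂ :=
  ∑ x : ZMod N, ZMod.stdAddChar (F.eval x)

theorem norm_completeSum_le_card (F : (ZMod N)[X]) : ‖completeSum F‖ ≤ N :=
  (norm_sum_le _ _).trans (by simp [AddChar.norm_apply])

theorem norm_completeSum_sq_le (F : (ZMod N)[X]) :
    ‖completeSum F‖ ^ 2 ≤ ∑ h : ZMod N, ‖completeSum (Polynomial.taylor h F - F)‖ := by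
  have differencing : ((‖completeSum F‖ ^ 2 : ℝ) : ℂ) =
      ∑ h : ZMod N, completeSum (Polynomial.taylor h F - F) := by
    push_cast
    simp only [completeSum]
    rw [← Complex.conj_mul', map_sum, sum_mul_sum, eq_comm, sum_comm]
    refine sum_congr rfl fun x _ => ?_
    rw [← Equiv.sum_comp (Equiv.addLeft x) (fun y => _ * _)]
    refine sum_congr rfl fun h _ => ?_
    simp [Polynomial.taylor_eval, sub_eq_add_neg, AddChar.map_add_eq_mul,
      AddChar.map_neg_eq_conj, mul_comm]
  calc ‖completeSum F‖ ^ 2 = ‖((‖completeSum F‖ ^ 2 : ℝ) : ℂ)‖ := by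
        rw [Complex.norm_of_nonneg (sq_nonneg _)]
    _ ≤ _ := by rw [differencing]; exact norm_sum_le _ _

/-- Power saving `κ`, in the additive order of the leading coefficient, for all complete
exponential sums of degree at most `d`. -/
def CompleteSumBound (d : ℕ) (κ C : ℝ) : Prop :=
  ∀ (N : ℕ) [NeZero N] (F : (ZMod N)[X]), F.natDegree ≤ d →
    ‖completeSum F‖ ≤ C * N * (addOrderOf (F.coeff d) : ℝ) ^ (-κ)

theorem completeSumBound_one (κ : ℝ) : CompleteSumBound 1 κ 1 := by
  intro N _ F hF
  by_cases hc : F.coeff 1 = 0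
  · simpa [hc] using norm_completeSum_le_card F
  have eval_eq : ∀ x, ZMod.stdAddChar (F.eval x) =
      ZMod.stdAddChar (F.coeff 0) * ZMod.stdAddChar (x * F.coeff 1) := fun x => by
    rw [Polynomial.eval_eq_sum_range' (Nat.lt_succ_of_le hF), ← AddChar.map_add_eq_mul]
    simp [sum_range_succ, mul_comm]
  have hzero : completeSum F = 0 := by
    simp_rw [completeSum, eval_eq]
    rw [← mul_sum, AddChar.sum_mulShift _ (ZMod.isPrimitive_stdAddChar N), if_neg hc,
      Nat.cast_zero, mul_zero]
  rw [hzero, norm_zero]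
  positivity

variable {d : ℕ} {κ C : ℝ}

theorem CompleteSumBound.norm_completeSum_taylor_sub_self_le (hb : CompleteSumBound d κ C)
    (hκ : 0 ≤ κ) (hκ1 : κ ≤ 1) (hC : 0 ≤ C) {F : (ZMod N)[X]} (hF : F.natDegree ≤ d + 1)
    {h : ZMod N} {y : ℝ} (hy : 0 < y) (hyh : y ≤ addOrderOf (h * F.coeff (d + 1))) :
    ‖completeSum (Polynomial.taylor h F - F)‖ ≤ C * (d + 1) * N * y ^ (-κ) := by
  have horder : y / (d + 1) ≤ addOrderOf ((d + 1) • (h * F.coeff (d + 1))) := by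
    rw [div_le_iff₀' (by positivity)]
    refine hyh.trans ?_
    exact_mod_cast addOrderOf_le_mul_addOrderOf_nsmul d.succ_pos (h * F.coeff (d + 1))
  calc ‖completeSum (Polynomial.taylor h F - F)‖
      ≤ C * N * (addOrderOf ((d + 1) • (h * F.coeff (d + 1))) : ℝ) ^ (-κ) := by
        rw [← coeff_taylor_sub_self hF]
        exact hb N _ (natDegree_taylor_sub_self_le hF h)
    _ ≤ C * N * (y / (d + 1)) ^ (-κ) := by
        gcongr ?_ * ?_
        exact Real.rpow_le_rpow_of_nonpos (by positivity) horder (by linarith)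
    _ = C * N * (((d : ℝ) + 1) ^ κ * y ^ (-κ)) := by
        rw [Real.div_rpow hy.le (by positivity), Real.rpow_neg (by positivity : (0 : ℝ) ≤ d + 1),
          div_inv_eq_mul, mul_comm (y ^ _)]
    _ ≤ C * N * ((d + 1) * y ^ (-κ)) := by
        gcongr
        exact Real.rpow_le_self_of_one_le (by simp) hκ1
    _ = C * (d + 1) * N * y ^ (-κ) := by ring

theorem CompleteSumBound.norm_completeSum_sq_le (hb : CompleteSumBound d κ C) (hκ : 0 ≤ κ)
    (hκ1 : κ ≤ 1) (hC : 0 ≤ C) {F : (ZMod N)[X]} (hF : F.natDegree ≤ d + 1) :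
    ‖completeSum F‖ ^ 2 ≤
      (C * (d + 1) + 1) * (N ^ 2 * (addOrderOf (F.coeff (d + 1)) : ℝ) ^ (-(κ / 3))) := by
  set c := F.coeff (d + 1)
  set q : ℝ := (addOrderOf c : ℝ) with hq
  have hq1 : 1 ≤ q := by rw [hq]; exact_mod_cast addOrderOf_pos c
  set bad : Finset (ZMod N) := {h | addOrderOf (h * c) ≤ ⌊q ^ (1 / 3 : ℝ)⌋₊}
  have sum_bad : ∑ h ∈ bad, ‖completeSum (Polynomial.taylor h F - F)‖ ≤
      N * q ^ (-(κ / 3)) * N :=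
    calc _ ≤ ∑ _ ∈ bad, (N : ℝ) := sum_le_sum fun _ _ => norm_completeSum_le_card _
      _ = #bad * N := by simp
      _ ≤ N * q ^ (-(1 / 3) : ℝ) * N := by gcongr; exact card_filter_addOrderOf_mul_le_rpow c
      _ ≤ N * q ^ (-(κ / 3)) * N := by gcongr
  have good_le : ∀ h ∈ badᶜ, ‖completeSum (Polynomial.taylor h F - F)‖ ≤
      C * (d + 1) * N * q ^ (-(κ / 3)) := fun h hh => by
    have hlt : ⌊q ^ (1 / 3 : ℝ)⌋₊ < addOrderOf (h * c) := by simpa [bad] using hh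
    refine (hb.norm_completeSum_taylor_sub_self_le hκ hκ1 hC hF (y := q ^ (1 / 3 : ℝ))
      (by positivity) (Nat.lt_of_floor_lt hlt).le).trans_eq ?_
    rw [← Real.rpow_mul (by positivity)]
    ring_nf
  have sum_good : ∑ h ∈ badᶜ, ‖completeSum (Polynomial.taylor h F - F)‖ ≤
      N * (C * (d + 1) * N * q ^ (-(κ / 3))) :=
    calc _ ≤ ∑ h ∈ badᶜ, C * (d + 1) * N * q ^ (-(κ / 3)) := sum_le_sum good_le
      _ ≤ ∑ h : ZMod N, C * (d + 1) * N * q ^ (-(κ / 3)) :=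
        sum_le_sum_of_subset_of_nonneg (subset_univ _) fun _ _ _ => by positivity
      _ = _ := by simp
  refine (PolyVariation.norm_completeSum_sq_le F).trans ?_
  rw [← sum_add_sum_compl bad]
  linarith

theorem CompleteSumBound.succ (hb : CompleteSumBound d κ C) (hκ : 0 ≤ κ) (hκ1 : κ ≤ 1)
    (hC : 0 ≤ C) : CompleteSumBound (d + 1) (κ / 6) (C * (d + 1) + 1) := by
  intro N _ F hF
  set q : ℝ := (addOrderOf (F.coeff (d + 1)) : ℝ)
  have hC1 : 1 ≤ C * (d + 1) + 1 := le_add_of_nonneg_left (by positivity)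
  refine le_of_sq_le_sq ?_ (by positivity)
  calc ‖completeSum F‖ ^ 2 ≤ (C * (d + 1) + 1) * (N ^ 2 * q ^ (-(κ / 3))) :=
        hb.norm_completeSum_sq_le hκ hκ1 hC hF
    _ ≤ (C * (d + 1) + 1) ^ 2 * (N ^ 2 * q ^ (-(κ / 3))) := by
        gcongr; exact le_self_pow₀ hC1 two_ne_zero
    _ = ((C * (d + 1) + 1) * N * q ^ (-(κ / 6))) ^ 2 := by
        rw [mul_pow, mul_pow, ← Real.rpow_mul_natCast (by positivity)]
        ring_nf

theorem exists_completeSumBound (d : ℕ) :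
    ∃ κ C : ℝ, 0 < κ ∧ κ ≤ 1 ∧ 0 ≤ C ∧ CompleteSumBound (d + 1) κ C := by
  induction d with
  | zero => exact ⟨1, 1, one_pos, le_rfl, zero_le_one, completeSumBound_one 1⟩
  | succ d ih =>
    obtain ⟨κ, C, hκ, hκ1, hC, hb⟩ := ih
    exact ⟨κ / 6, _, by positivity, by linarith, by positivity, hb.succ hκ.le hκ1 hC⟩

end CompleteSums

/-! ### Means, partial summation and the Kusmin–Landau inequality -/

section Means

variable {E : Type*} [SeminormedAddCommGroup E] [NormedSpace ℝ E]

/-- The mean `(z 1 + ⋯ + z t) / t`. -/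
noncomputable def natAvg (z : ℕ → E) (t : ℕ) : E := (t : ℝ)⁻¹ • ∑ i ∈ range t, z (i + 1)

theorem natAvg_sub_const (z : ℕ → E) (c : E) {t : ℕ} (ht : 0 < t) :
    natAvg (fun m => z m - c) t = natAvg z t - c := by
  have ht' : (t : ℝ) ≠ 0 := by positivity
  rw [natAvg, natAvg, sum_sub_distrib, smul_sub, sum_const, card_range, ← Nat.cast_smul_eq_nsmul ℝ,
    inv_smul_smul₀ ht']

theorem norm_natAvg_le {z : ℕ → E} {B : ℝ} {t : ℕ} (ht : 0 < t)
    (hz : ∀ m ∈ Set.Icc 1 t, ‖z m‖ ≤ B) : ‖natAvg z t‖ ≤ B := by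
  have ht' : (0 : ℝ) < t := by exact_mod_cast ht
  rw [natAvg, norm_smul, norm_inv, Real.norm_natCast, inv_mul_le_iff₀ ht']
  calc ‖∑ i ∈ range t, z (i + 1)‖ ≤ ∑ _ ∈ range t, B :=
        norm_sum_le_of_le _ fun i hi => hz _ ⟨by omega, mem_range.1 hi⟩
    _ = t * B := by simp

theorem norm_natAvg_sub_natAvg_le {z : ℕ → E} {c : E} {B : ℝ} {N M t t' : ℕ} (hN : 0 < N)
    (hz : ∀ m ∈ Set.Icc 1 M, ‖z m - c‖ ≤ B) (ht : t ∈ Set.Icc N M) (ht' : t' ∈ Set.Icc N M) :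
    ‖natAvg z t - natAvg z t'‖ ≤ 2 * B * (|(t : ℝ) - t'| / N) := by
  wlog htt : t' ≤ t generalizing t t'
  · rw [norm_sub_rev, abs_sub_comm]
    exact this ht' ht (by omega)
  obtain ⟨k, rfl⟩ := Nat.exists_eq_add_of_le htt
  have ht0 : 0 < t' := hN.trans_le ht'.1
  have hmem : ∀ m ∈ Set.Icc 1 t', ‖z m - c‖ ≤ B := fun m hm => hz m ⟨hm.1, hm.2.trans ht'.2⟩
  have difference_eq : natAvg z (t' + k) - natAvg z t' = ((t' + k : ℕ) : ℝ)⁻¹ •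
      (∑ i ∈ range k, (z (t' + i + 1) - c) - (k : ℝ) • natAvg (fun m => z m - c) t') := by
    rw [← sub_sub_sub_cancel_right _ _ c, ← natAvg_sub_const z c (by omega),
      ← natAvg_sub_const z c ht0]
    have hk : (t' : ℝ) ≠ 0 := by positivity
    have htk : ((t' + k : ℕ) : ℝ) ≠ 0 := by positivity
    have hsum : ∑ i ∈ range t', (z (i + 1) - c) = (t' : ℝ) • natAvg (fun m => z m - c) t' := by
      rw [natAvg, smul_inv_smul₀ hk]
    rw [natAvg, sum_range_add, hsum, ← smul_right_inj htk, smul_inv_smul₀ htk, smul_sub,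
      smul_inv_smul₀ htk]
    push_cast
    module
  have hB : 0 ≤ B := (norm_nonneg _).trans (hmem 1 ⟨le_rfl, ht0⟩)
  calc ‖natAvg z (t' + k) - natAvg z t'‖
      ≤ ((t' + k : ℕ) : ℝ)⁻¹ * (∑ _ ∈ range k, B + k * B) := by
        rw [difference_eq, norm_smul, norm_inv, Real.norm_natCast]
        gcongr
        refine norm_sub_le_of_le (norm_sum_le_of_le _ fun i hi => hz _ ⟨by omega, ?_⟩) ?_
        · have := mem_range.1 hi
          have := ht.2
          omega
        · rw [norm_smul, Real.norm_natCast]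
          gcongr
          exact norm_natAvg_le ht0 hmem
    _ = 2 * B * (k / (t' + k : ℕ)) := by rw [sum_const, card_range, nsmul_eq_mul]; ring
    _ ≤ 2 * B * (|((t' + k : ℕ) : ℝ) - t'| / N) := by
        push_cast
        rw [add_sub_cancel_left, Nat.abs_cast]
        gcongr
        exact_mod_cast ht.1

theorem norm_sum_smul_le_of_norm_sum_le {R F : Type*} [SeminormedRing R] [SeminormedAddCommGroup F]
    [Module R F] [IsBoundedSMul R F] {u : ℕ → R} {w : ℕ → F} {W : ℝ} {t : ℕ}
    (hW : ∀ k ≤ t, ‖∑ i ∈ range k, w i‖ ≤ W) :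
    ‖∑ i ∈ range t, u i • w i‖ ≤
      (‖u (t - 1)‖ + ∑ i ∈ range (t - 1), ‖u (i + 1) - u i‖) * W := by
  rw [sum_range_by_parts, add_mul, sum_mul]
  refine norm_sub_le_of_le ?_ (norm_sum_le_of_le _ fun i hi => ?_)
  · exact (norm_smul_le _ _).trans (by gcongr; exact hW t le_rfl)
  · refine (norm_smul_le _ _).trans ?_
    gcongr
    exact hW _ (by have := mem_range.1 hi; omega)

theorem norm_sum_range_le_of_periodic {F : Type*} [SeminormedAddCommGroup F] {w : ℕ → F} {N : ℕ}
    {B : ℝ} (hN : 0 < N) (hper : ∀ i, w (N + i) = w i) (hsum : ∑ i ∈ range N, w i = 0)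
    (hw : ∀ i, ‖w i‖ ≤ B) (k : ℕ) : ‖∑ i ∈ range k, w i‖ ≤ N * B := by
  induction k using Nat.strong_induction_on with
  | _ k ih =>
    rcases lt_or_ge k N with hkN | hkN
    · have hB : 0 ≤ B := (norm_nonneg _).trans (hw 0)
      calc ‖∑ i ∈ range k, w i‖ ≤ ∑ _ ∈ range k, B := norm_sum_le_of_le _ fun i _ => hw i
        _ = k * B := by simp
        _ ≤ N * B := by gcongr
    · obtain ⟨j, rfl⟩ := Nat.exists_eq_add_of_le hkN
      rw [sum_range_add, hsum, zero_add, sum_congr rfl fun i _ => hper i]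
      exact ih j (by omega)

theorem norm_natAvg_mul_sub_le_of_periodic {z u : ℕ → ℂ} {N t : ℕ} {D : ℝ} (hN : 0 < N)
    (ht : 0 < t) (hper : ∀ m, z (N + m) = z m) (hz : ∀ m, ‖z m‖ ≤ 1) (hu : ‖u t‖ ≤ 1)
    (hD : ∀ m ∈ Set.Ico 1 t, ‖u (m + 1) - u m‖ ≤ D) (hD0 : 0 ≤ D) :
    ‖natAvg (fun m => z m * u m) t - natAvg z N * natAvg u t‖ ≤ 2 * N * (1 + t * D) / t := by
  have hN' : (N : ℝ) ≠ 0 := by positivity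
  let w : ℕ → ℂ := fun i => z (i + 1) - natAvg z N
  have hw_per : ∀ i, w (N + i) = w i := fun i => by simp only [w, add_assoc, hper]
  have hw_sum : ∑ i ∈ range N, w i = 0 := by
    rw [sum_sub_distrib, sum_const, card_range, ← Nat.cast_smul_eq_nsmul ℝ, natAvg,
      smul_inv_smul₀ hN', sub_self]
  have hw_norm : ∀ i, ‖w i‖ ≤ 2 := fun i =>
    (norm_sub_le_of_le (hz _) (norm_natAvg_le hN fun m _ => hz m)).trans_eq one_add_one_eq_two
  have difference_eq : natAvg (fun m => z m * u m) t - natAvg z N * natAvg u t =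
      (t : ℝ)⁻¹ • ∑ i ∈ range t, u (i + 1) • w i := by
    rw [natAvg, natAvg.eq_def u, mul_smul_comm, ← smul_sub, mul_sum, ← sum_sub_distrib]
    simp only [w, smul_eq_mul]
    congr 1
    exact sum_congr rfl fun i _ => by ring
  rw [difference_eq, norm_smul, norm_inv, Real.norm_natCast, inv_mul_eq_div]
  gcongr
  calc ‖∑ i ∈ range t, u (i + 1) • w i‖
      ≤ (‖u (t - 1 + 1)‖ + ∑ i ∈ range (t - 1), ‖u (i + 1 + 1) - u (i + 1)‖) * (N * 2) :=
        norm_sum_smul_le_of_norm_sum_le fun k _ =>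
          norm_sum_range_le_of_periodic hN hw_per hw_sum hw_norm k
    _ ≤ (1 + ∑ _ ∈ range (t - 1), D) * (N * 2) := by
        rw [Nat.sub_add_cancel ht]
        gcongr with i hi
        exact hD _ (by have := mem_range.1 hi; constructor <;> omega)
    _ = 2 * N * (1 + (t - 1 : ℕ) * D) := by simp; ring
    _ ≤ 2 * N * (1 + t * D) := by gcongr; omega

end Means

section FourierChar

theorem norm_fourierChar_sub_le (x y : ℝ) : ‖(𝐞 x - 𝐞 y : ℂ)‖ ≤ 2 * Real.pi * |x - y| := by
  have hfactor : (𝐞 x - 𝐞 y : ℂ) = 𝐞 y * (𝐞 (x - y) - 1) := by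
    rw [mul_sub, ← Circle.coe_mul, ← AddChar.map_add_eq_mul, add_sub_cancel, mul_one]
  rw [hfactor, norm_mul, Circle.norm_coe, one_mul, Real.fourierChar_apply, mul_comm _ Complex.I]
  refine Real.norm_exp_I_mul_ofReal_sub_one_le.trans_eq ?_
  rw [Real.norm_eq_abs, abs_mul, abs_of_pos Real.two_pi_pos]

theorem four_mul_abs_le_norm_fourierChar_sub_one {x : ℝ} (hx : |x| ≤ 1 / 2) :
    4 * |x| ≤ ‖(𝐞 x - 1 : ℂ)‖ := by
  have hsin : 2 / Real.pi * |Real.pi * x| ≤ |Real.sin (Real.pi * x)| := by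
    refine Real.mul_abs_le_abs_sin ?_
    rw [abs_mul, abs_of_pos Real.pi_pos]
    nlinarith [Real.pi_pos]
  calc 4 * |x| = 2 * (2 / Real.pi * |Real.pi * x|) := by
        rw [abs_mul, abs_of_pos Real.pi_pos]
        field_simp
        ring
    _ ≤ 2 * |Real.sin (Real.pi * x)| := by gcongr
    _ = ‖(𝐞 x - 1 : ℂ)‖ := by
        rw [Real.fourierChar_apply, mul_comm _ Complex.I, Complex.norm_exp_I_mul_ofReal_sub_one,
          Real.norm_eq_abs, abs_mul, abs_two, mul_assoc, mul_div_cancel_left₀ _ two_ne_zero]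

/-- Kusmin–Landau with bounded second differences in place of monotone first differences. -/
theorem norm_sum_fourierChar_le {θ : ℕ → ℝ} {t : ℕ} {l μ : ℝ} (hl : 0 < l) (hμ : 0 ≤ μ)
    (hlower : ∀ i < t, l ≤ |θ (i + 1) - θ i|) (hupper : ∀ i < t, |θ (i + 1) - θ i| ≤ 1 / 2)
    (hsecond : ∀ i, i + 1 < t → |(θ (i + 2) - θ (i + 1)) - (θ (i + 1) - θ i)| ≤ μ) :
    ‖∑ i ∈ range t, (𝐞 (θ i) : ℂ)‖ ≤ 1 / (2 * l) + t * (Real.pi * μ / (4 * l ^ 2)) := by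
  rcases t.eq_zero_or_pos with rfl | ht
  · simpa using hl.le
  let D : ℕ → ℂ := fun i => 𝐞 (θ (i + 1) - θ i) - 1
  have hD : ∀ i < t, 4 * l ≤ ‖D i‖ := fun i hi =>
    (mul_le_mul_of_nonneg_left (hlower i hi) zero_le_four).trans
      (four_mul_abs_le_norm_fourierChar_sub_one (hupper i hi))
  have hD0 : ∀ i < t, D i ≠ 0 := fun i hi =>
    norm_pos_iff.1 (lt_of_lt_of_le (by positivity) (hD i hi))
  have term_eq : ∀ i ∈ range t, (𝐞 (θ i) : ℂ) = (D i)⁻¹ • (𝐞 (θ (i + 1)) - 𝐞 (θ i) : ℂ) := by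
    intro i hi
    rw [smul_eq_mul, eq_inv_mul_iff_mul_eq₀ (hD0 i (mem_range.1 hi)), sub_mul, one_mul,
      ← Circle.coe_mul, ← AddChar.map_add_eq_mul, sub_add_cancel]
  have telescoped_le : ∀ k ≤ t, ‖∑ i ∈ range k, (𝐞 (θ (i + 1)) - 𝐞 (θ i) : ℂ)‖ ≤ 2 := by
    intro k _
    rw [sum_range_sub fun i => (𝐞 (θ i) : ℂ)]
    exact (norm_sub_le _ _).trans_eq (by simp only [Circle.norm_coe]; norm_num)
  have inv_sub_le : ∀ i ∈ range (t - 1),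
      ‖(D (i + 1))⁻¹ - (D i)⁻¹‖ ≤ 2 * Real.pi * μ / (4 * l) ^ 2 := by
    intro i hi
    have hi : i + 1 < t := by have := mem_range.1 hi; omega
    rw [inv_sub_inv (hD0 _ hi) (hD0 _ (by omega)), norm_div, norm_mul, sq]
    gcongr
    · rw [sub_sub_sub_cancel_right]
      refine (norm_fourierChar_sub_le _ _).trans ?_
      rw [abs_sub_comm]
      gcongr
      exact hsecond i hi
    · exact hD _ hi
    · exact hD _ (by omega)
  rw [sum_congr rfl term_eq]
  calc _ ≤ (‖(D (t - 1))⁻¹‖ + ∑ i ∈ range (t - 1), ‖(D (i + 1))⁻¹ - (D i)⁻¹‖) * 2 :=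
        norm_sum_smul_le_of_norm_sum_le telescoped_le
    _ ≤ ((4 * l)⁻¹ + ∑ _ ∈ range t, 2 * Real.pi * μ / (4 * l) ^ 2) * 2 := by
        rw [norm_inv]
        gcongr ((?_)⁻¹ + ?_) * 2
        · exact hD _ (by omega)
        · exact (sum_le_sum inv_sub_le).trans (sum_le_sum_of_subset_of_nonneg
            (range_mono (by omega)) fun _ _ _ => by positivity)
    _ = _ := by rw [sum_const, card_range, nsmul_eq_mul]; field_simp; ring

end FourierChar

/-! ### Polynomial growth -/

section Growth

/-- Regularity of polynomial type for the phase `p`: up to constants, `p m - p 0` is at most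
`m ^ (e + 1)`, the increments of `p` have size `m ^ e` (from below only for `m ≥ M`), and its second
differences are at most `m ^ (e - 1)`, in a form that makes sense for `e = 0` too. -/
structure RegularGrowth (p : ℕ → ℝ) (e : ℕ) (C : ℝ) (M : ℕ) : Prop where
  one_le : 1 ≤ C
  abs_sub_le : ∀ m, 1 ≤ m → |p m - p 0| ≤ C * (m : ℝ) ^ (e + 1)
  abs_diff_le : ∀ m, 1 ≤ m → |p (m + 1) - p m| ≤ C * (m : ℝ) ^ e
  mul_abs_diff_diff_le : ∀ m, 1 ≤ m →
    m * |(p (m + 2) - p (m + 1)) - (p (m + 1) - p m)| ≤ C * (m : ℝ) ^ e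
  le_abs_diff : ∀ m, M ≤ m → (m : ℝ) ^ e / 2 ≤ |p (m + 1) - p m|

/-- The real sequence of values of an integer polynomial at the natural numbers. -/
def evalSeq (P : ℤ[X]) (m : ℕ) : ℝ := (P.eval (m : ℤ) : ℤ)

theorem evalSeq_taylor_one_sub_self (P : ℤ[X]) (m : ℕ) :
    evalSeq (Polynomial.taylor 1 P - P) m = evalSeq P (m + 1) - evalSeq P m := by
  simp [evalSeq, Polynomial.taylor_eval]

theorem exists_mul_abs_evalSeq_le {Q : ℤ[X]} {k : ℕ} (hQ : Q.degree < k) :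
    ∃ C : ℝ, 0 ≤ C ∧ ∀ m : ℕ, 1 ≤ m → m * |evalSeq Q m| ≤ C * (m : ℝ) ^ k := by
  rcases eq_or_ne Q 0 with rfl | hQ0
  · exact ⟨0, le_rfl, by simp [evalSeq]⟩
  refine ⟨∑ i ∈ range k, |(Q.coeff i : ℝ)|, by positivity, fun m hm => ?_⟩
  have hm1 : (1 : ℝ) ≤ m := by exact_mod_cast hm
  rw [evalSeq, Polynomial.eval_eq_sum_range' ((Polynomial.natDegree_lt_iff_degree_lt hQ0).2 hQ)]
  push_cast
  calc m * |∑ i ∈ range k, (Q.coeff i : ℝ) * (m : ℝ) ^ i|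
      ≤ m * ∑ i ∈ range k, |(Q.coeff i : ℝ)| * (m : ℝ) ^ i := by
        gcongr
        refine (abs_sum_le_sum_abs _ _).trans_eq (sum_congr rfl fun i _ => ?_)
        rw [abs_mul, abs_pow, Nat.abs_cast]
    _ = ∑ i ∈ range k, |(Q.coeff i : ℝ)| * (m : ℝ) ^ (i + 1) := by
        rw [mul_sum]
        exact sum_congr rfl fun i _ => by ring
    _ ≤ ∑ i ∈ range k, |(Q.coeff i : ℝ)| * (m : ℝ) ^ k := by
        gcongr with i hi
        exact mem_range.1 hi
    _ = _ := (sum_mul _ _ _).symm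

theorem exists_abs_evalSeq_le {Q : ℤ[X]} {k : ℕ} (hQ : Q.natDegree ≤ k) :
    ∃ C : ℝ, 0 ≤ C ∧ ∀ m : ℕ, 1 ≤ m → |evalSeq Q m| ≤ C * (m : ℝ) ^ k := by
  obtain ⟨C, hC, hbound⟩ := exists_mul_abs_evalSeq_le (k := k + 1)
    (Polynomial.degree_le_natDegree.trans_lt (by exact_mod_cast Nat.lt_succ_of_le hQ))
  refine ⟨C, hC, fun m hm => ?_⟩
  have hm0 : (0 : ℝ) < m := by exact_mod_cast hm
  refine le_of_mul_le_mul_left ((hbound m hm).trans_eq ?_) hm0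
  ring

theorem exists_le_abs_evalSeq {Q : ℤ[X]} {k : ℕ} (hQ : Q.natDegree ≤ k) (hk : Q.coeff k ≠ 0) :
    ∃ M : ℕ, ∀ m : ℕ, M ≤ m → (m : ℝ) ^ k / 2 ≤ |evalSeq Q m| := by
  have hdeg : (Q - Polynomial.C (Q.coeff k) * Polynomial.X ^ k).degree < (k : WithBot ℕ) := by
    rw [Polynomial.degree_lt_iff_coeff_zero]
    intro i hi
    rw [Polynomial.coeff_sub, Polynomial.coeff_C_mul_X_pow]
    split_ifs with hik
    · rw [hik, sub_self]
    · rw [Polynomial.coeff_eq_zero_of_natDegree_lt (by omega), sub_zero]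
  obtain ⟨C, -, hbound⟩ := exists_mul_abs_evalSeq_le hdeg
  refine ⟨⌈2 * C⌉₊ + 1, fun m hm => ?_⟩
  have hm0 : (0 : ℝ) < m := by exact_mod_cast (by omega : 0 < m)
  have hCm : 2 * C ≤ m := (Nat.le_ceil _).trans (by exact_mod_cast (by omega))
  have hlead : (m : ℝ) ^ k ≤ |Q.coeff k * (m : ℝ) ^ k| := by
    rw [abs_mul, abs_pow, Nat.abs_cast]
    exact le_mul_of_one_le_left (by positivity) (by exact_mod_cast Int.one_le_abs hk)
  have hrest : |evalSeq Q m - Q.coeff k * (m : ℝ) ^ k| ≤ (m : ℝ) ^ k / 2 := by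
    have := hbound m (by omega)
    simp only [evalSeq, Polynomial.eval_sub, Polynomial.eval_mul, Polynomial.eval_C,
      Polynomial.eval_pow, Polynomial.eval_X, Int.cast_sub, Int.cast_mul, Int.cast_pow,
      Int.cast_natCast] at this
    refine le_of_mul_le_mul_left (this.trans ?_) hm0
    nlinarith [pow_pos hm0 k]
  have := abs_sub_abs_le_abs_sub (Q.coeff k * (m : ℝ) ^ k) (evalSeq Q m)
  rw [abs_sub_comm] at this
  linarith

theorem degree_taylor_sub_self_lt {Q : ℤ[X]} {k : ℕ} (hQ : Q.natDegree ≤ k) :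
    (Polynomial.taylor 1 Q - Q).degree < k := by
  rcases eq_or_ne Q 0 with rfl | hQ0
  · simp [bot_lt_iff_ne_bot]
  calc (Polynomial.taylor 1 Q - Q).degree < (Polynomial.taylor 1 Q).degree :=
        Polynomial.degree_sub_lt_left (Polynomial.degree_taylor _ _)
          (by rwa [ne_eq, Polynomial.taylor_eq_zero]) (Polynomial.leadingCoeff_taylor _ _)
    _ = Q.degree := Polynomial.degree_taylor _ _
    _ ≤ k := Polynomial.degree_le_natDegree.trans (by exact_mod_cast hQ)

theorem exists_regularGrowth_evalSeq {P : ℤ[X]} {e : ℕ} (hP : P.natDegree = e + 1) :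
    ∃ C M, RegularGrowth (evalSeq P) e C M := by
  let Q := Polynomial.taylor 1 P - P
  have hQ : Q.natDegree ≤ e := natDegree_taylor_sub_self_le hP.le 1
  have hQcoeff : Q.coeff e ≠ 0 := by
    have hlead : P.coeff (e + 1) ≠ 0 := by
      rw [← hP, Polynomial.coeff_natDegree, Polynomial.leadingCoeff_ne_zero]
      rintro rfl
      simp at hP
    rw [coeff_taylor_sub_self hP.le, one_mul]
    exact smul_ne_zero e.succ_ne_zero hlead
  obtain ⟨C₁, hC₁, hvalue⟩ := exists_abs_evalSeq_le (Q := P - Polynomial.C (P.eval 0))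
    (by rw [Polynomial.natDegree_sub_C, hP])
  obtain ⟨C₂, hC₂, hdiff⟩ := exists_abs_evalSeq_le hQ
  obtain ⟨C₃, hC₃, hdiff₂⟩ := exists_mul_abs_evalSeq_le (degree_taylor_sub_self_lt hQ)
  obtain ⟨M, hlower⟩ := exists_le_abs_evalSeq hQ hQcoeff
  simp only [Q, evalSeq_taylor_one_sub_self] at hdiff hdiff₂ hlower
  refine ⟨1 + C₁ + C₂ + C₃, M, by linarith, fun m hm => ?_, fun m hm => (hdiff m hm).trans ?_,
    fun m hm => (hdiff₂ m hm).trans ?_, hlower⟩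
  · have hsub : evalSeq (P - Polynomial.C (P.eval 0)) m = evalSeq P m - evalSeq P 0 := by
      simp [evalSeq]
    rw [← hsub]
    refine (hvalue m hm).trans ?_
    gcongr
    linarith
  · gcongr
    linarith
  · gcongr
    linarith

end Growth

/-! ### Oscillatory means -/

section PhaseMean

/-- The mean `(1 / t) ∑_{m = 1}^t e(p(m) x)`. -/
noncomputable def phaseMean (p : ℕ → ℝ) (t : ℕ) (x : ℝ) : ℂ :=
  natAvg (fun m => (𝐞 (p m * x) : ℂ)) t

variable {p : ℕ → ℝ} {e M n : ℕ} {C x : ℝ}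

theorem norm_phaseMean_sub_le {B : ℝ} {c : ℝ} {t t' : ℕ}
    (hB : ∀ m ∈ Set.Icc 1 (2 ^ (n + 1)), |p m * x - c| ≤ B)
    (ht : t ∈ Set.Icc (2 ^ n) (2 ^ (n + 1))) (ht' : t' ∈ Set.Icc (2 ^ n) (2 ^ (n + 1))) :
    ‖phaseMean p t x - phaseMean p t' x‖ ≤ 4 * Real.pi * B * (|(t : ℝ) - t'| / 2 ^ n) := by
  have := norm_natAvg_sub_natAvg_le (z := fun m => (𝐞 (p m * x) : ℂ)) (c := 𝐞 c)
    (B := 2 * Real.pi * B) (by positivity) (fun m hm => (norm_fourierChar_sub_le _ _).trans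
      (by gcongr; exact hB m hm)) ht ht'
  push_cast at this
  refine this.trans_eq ?_
  ring

theorem norm_phaseMean_sub_le_two_mul (p : ℕ → ℝ) (x : ℝ) {t t' : ℕ}
    (ht : t ∈ Set.Icc (2 ^ n) (2 ^ (n + 1))) (ht' : t' ∈ Set.Icc (2 ^ n) (2 ^ (n + 1))) :
    ‖phaseMean p t x - phaseMean p t' x‖ ≤ 2 * (|(t : ℝ) - t'| / 2 ^ n) := by
  have := norm_natAvg_sub_natAvg_le (z := fun m => (𝐞 (p m * x) : ℂ)) (c := 0) (B := 1)
    (by positivity) (fun m _ => by rw [sub_zero, Circle.norm_coe]) ht ht'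
  push_cast at this
  rwa [mul_one] at this

theorem abs_sub_div_two_pow_le_one {t t' : ℕ} (ht : t ∈ Set.Icc (2 ^ n) (2 ^ (n + 1)))
    (ht' : t' ∈ Set.Icc (2 ^ n) (2 ^ (n + 1))) : |(t : ℝ) - t'| / 2 ^ n ≤ 1 := by
  rw [div_le_one (by positivity)]
  have := abs_sub_le_of_le_of_le (a := (t : ℝ)) (b := t') (lb := 2 ^ n) (ub := 2 ^ (n + 1))
    (by exact_mod_cast ht.1) (by exact_mod_cast ht.2) (by exact_mod_cast ht'.1)
    (by exact_mod_cast ht'.2)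
  rw [pow_succ] at this
  linarith

theorem dyadicEnergy_phaseMean_le (p : ℕ → ℝ) (n : ℕ) (x : ℝ) :
    dyadicEnergy n (fun t => phaseMean p t x) ≤ 56 := by
  have := dyadicEnergy_le (n := n) zero_le_two zero_le_one
    (fun t ht t' ht' => norm_phaseMean_sub_le_two_mul p x ht ht') fun t ht t' ht' =>
      (norm_phaseMean_sub_le_two_mul p x ht ht').trans
        (by gcongr; exact abs_sub_div_two_pow_le_one ht ht')
  norm_num at this
  exact this

theorem RegularGrowth.norm_sum_fourierChar_mul_le (hp : RegularGrowth p e C M) (hx : x ≠ 0)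
    {L k t : ℕ} (hL : 0 < L) (hML : M ≤ L) (hkt : L + k ≤ t)
    (hsmall : 2 * C * (t : ℝ) ^ e * |x| ≤ 1) :
    ‖∑ i ∈ range k, (𝐞 (p (L + i + 1) * x) : ℂ)‖ ≤ 1 / (|x| * (L : ℝ) ^ e) +
      k * (Real.pi * C * (t : ℝ) ^ e / (|x| * (L : ℝ) ^ (2 * e + 1))) := by
  have := abs_pos.2 hx
  have hL0 : (0 : ℝ) < L := by exact_mod_cast hL
  have hC : 0 < C := one_pos.trans_le hp.one_le
  refine (norm_sum_fourierChar_le (θ := fun i => p (L + i + 1) * x)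
    (l := (L : ℝ) ^ e / 2 * |x|) (μ := C * (t : ℝ) ^ e / L * |x|)
    (by positivity) (by positivity) (fun i _ => ?_) (fun i hi => ?_) fun i hi => ?_).trans_eq ?_
  · rw [← sub_mul, abs_mul]
    gcongr
    refine le_trans ?_ (hp.le_abs_diff (L + i + 1) (by omega))
    gcongr
    omega
  · rw [← sub_mul, abs_mul]
    calc _ ≤ C * (t : ℝ) ^ e * |x| := by
          gcongr
          refine (hp.abs_diff_le (L + i + 1) (by omega)).trans ?_
          gcongr
          omega
      _ ≤ 1 / 2 := by linarith
  · rw [← sub_mul, ← sub_mul, ← sub_mul, abs_mul]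
    gcongr
    rw [le_div_iff₀' hL0]
    calc _ ≤ ((L + i + 1 : ℕ) : ℝ) *
          |(p (L + i + 1 + 2) - p (L + i + 1 + 1)) - (p (L + i + 1 + 1) - p (L + i + 1))| :=
            mul_le_mul_of_nonneg_right (by exact_mod_cast (by omega)) (abs_nonneg _)
      _ ≤ C * ((L + i + 1 : ℕ) : ℝ) ^ e := hp.mul_abs_diff_diff_le _ (by omega)
      _ ≤ C * (t : ℝ) ^ e := by gcongr; omega
  · rw [pow_succ, two_mul e, pow_add]
    field_simp
    ring

theorem RegularGrowth.norm_phaseMean_le (hp : RegularGrowth p e C M) (hx : x ≠ 0) {L t : ℕ}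
    (hL : 0 < L) (hML : M ≤ L) (hLt : L ≤ t) (hsmall : 2 * C * (t : ℝ) ^ e * |x| ≤ 1) :
    ‖phaseMean p t x‖ ≤ (L + 1 / (|x| * (L : ℝ) ^ e) +
      t * (Real.pi * C * (t : ℝ) ^ e / (|x| * (L : ℝ) ^ (2 * e + 1)))) / t := by
  have hC : 0 < C := one_pos.trans_le hp.one_le
  have hsplit : t = L + (t - L) := by omega
  rw [phaseMean, natAvg, norm_smul, norm_inv, Real.norm_natCast, inv_mul_eq_div, add_assoc]
  gcongr
  conv_lhs => rw [hsplit, sum_range_add]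
  refine norm_add_le_of_le ((norm_sum_le_of_le _ fun i _ => (Circle.norm_coe _).le).trans ?_)
    ((hp.norm_sum_fourierChar_mul_le hx hL hML hsplit.ge hsmall).trans ?_)
  · simp
  · gcongr
    omega

/-- The cut `L = ⌈ε t⌉` balances the trivial bound for `m ≤ L` against Kusmin–Landau for `m > L`. -/
theorem RegularGrowth.norm_phaseMean_le_mul (hp : RegularGrowth p e C M) {t : ℕ} {ε : ℝ}
    (hε0 : 0 < ε) (hε1 : ε ≤ 1) (hε : 1 ≤ |x| * (t : ℝ) ^ (e + 1) * ε ^ (2 * e + 2))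
    (hone : 1 ≤ ε * t) (hM : M ≤ ε * t) (hsmall : 2 * C * (t : ℝ) ^ e * |x| ≤ 1) :
    ‖phaseMean p t x‖ ≤ (3 + Real.pi * C) * ε := by
  have hC : 0 < C := one_pos.trans_le hp.one_le
  have ht : (0 : ℝ) < t := by nlinarith
  have hx : x ≠ 0 := by
    rintro rfl
    norm_num at hε
  have := abs_pos.2 hx
  have hL : ε * t ≤ ⌈ε * t⌉₊ := Nat.le_ceil _
  have inv_le : ∀ j ≤ 2 * e + 1, 1 / (|x| * (t : ℝ) ^ (e + 1) * ε ^ j) ≤ ε := by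
    intro j hj
    rw [div_le_iff₀ (by positivity)]
    calc (1 : ℝ) ≤ |x| * (t : ℝ) ^ (e + 1) * ε ^ (2 * e + 2) := hε
      _ ≤ |x| * (t : ℝ) ^ (e + 1) * ε ^ (j + 1) := by
          gcongr _ * ?_
          exact pow_le_pow_of_le_one hε0.le hε1 (by omega)
      _ = _ := by ring
  refine (hp.norm_phaseMean_le hx (L := ⌈ε * t⌉₊) (Nat.ceil_pos.2 (by positivity))
    (by exact_mod_cast hM.trans hL) (Nat.ceil_le.2 (mul_le_of_le_one_left ht.le hε1))
    hsmall).trans ?_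
  rw [div_le_iff₀ ht]
  have cut_le : (⌈ε * t⌉₊ : ℝ) ≤ 2 * ε * t := by
    linarith [Nat.ceil_lt_add_one (a := ε * t) (by positivity)]
  have boundary_le : 1 / (|x| * (⌈ε * t⌉₊ : ℝ) ^ e) ≤ ε * t :=
    calc _ ≤ 1 / (|x| * (ε * t) ^ e) := by gcongr
      _ = 1 / (|x| * (t : ℝ) ^ (e + 1) * ε ^ e) * t := by field_simp; ring
      _ ≤ ε * t := by gcongr; exact inv_le e (by omega)
  have curvature_le : t * (Real.pi * C * (t : ℝ) ^ e / (|x| * (⌈ε * t⌉₊ : ℝ) ^ (2 * e + 1))) ≤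
      Real.pi * C * ε * t :=
    calc _ ≤ t * (Real.pi * C * (t : ℝ) ^ e / (|x| * (ε * t) ^ (2 * e + 1))) := by gcongr
      _ = Real.pi * C * (1 / (|x| * (t : ℝ) ^ (e + 1) * ε ^ (2 * e + 1))) * t := by
          field_simp; ring
      _ ≤ _ := by gcongr; exact inv_le _ le_rfl
  linarith

theorem mul_rpow_neg_one_div_pow_eq_one {X : ℝ} (hX : 0 < X) (e : ℕ) :
    X * (X ^ (-(1 / (2 * (e + 1))) : ℝ)) ^ (2 * e + 2) = 1 := by
  rw [← Real.rpow_natCast, ← Real.rpow_mul hX.le]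
  have : (-(1 / (2 * ((e : ℝ) + 1)))) * ((2 * e + 2 : ℕ) : ℝ) = -1 := by
    push_cast
    field_simp
  rw [this, Real.rpow_neg_one, mul_inv_cancel₀ hX.ne']

theorem RegularGrowth.eventually_norm_phaseMean_le (hp : RegularGrowth p e C M) :
    ∀ᶠ n : ℕ in atTop, ∀ x X : ℝ, X = |x| * ((2 : ℝ) ^ n) ^ (e + 1) → 1 ≤ X →
      X ≤ ((2 : ℝ) ^ n) ^ (1 / 10 : ℝ) → ∀ t ∈ Set.Icc (2 ^ n) (2 ^ (n + 1)),
        ‖phaseMean p t x‖ ≤ (3 + Real.pi * C) * X ^ (-(1 / (2 * (e + 1))) : ℝ) := by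
  have hlim : Tendsto (fun n : ℕ => ((2 : ℝ) ^ n) ^ (9 / 10 : ℝ)) atTop atTop :=
    (tendsto_rpow_atTop (by norm_num)).comp (tendsto_pow_atTop_atTop_of_one_lt one_lt_two)
  have hC : 1 ≤ C := hp.one_le
  filter_upwards [hlim.eventually_ge_atTop ((M : ℝ) + 2 * C * 2 ^ e)]
    with n hn x X hX hX1 hXle t ht
  have hX0 : 0 < X := by linarith
  have hZ : (0 : ℝ) < 2 ^ n := by positivity
  have hZt : (2 : ℝ) ^ n ≤ t := by exact_mod_cast ht.1
  have htZ : (t : ℝ) ≤ 2 * 2 ^ n := by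
    rw [← pow_succ']
    exact_mod_cast ht.2
  have hsplit : ((2 : ℝ) ^ n) ^ (1 / 10 : ℝ) * ((2 : ℝ) ^ n) ^ (9 / 10 : ℝ) = 2 ^ n := by
    rw [← Real.rpow_add hZ]
    norm_num
  generalize (2 : ℝ) ^ n = Z at *
  generalize hR : Z ^ (9 / 10 : ℝ) = R, Z ^ (1 / 10 : ℝ) = W at *
  have hR0 : 0 < R := hR ▸ by positivity
  have hXR : X * R ≤ Z := hsplit ▸ by gcongr
  have hC2 : 1 ≤ 2 * C * 2 ^ e := by nlinarith [one_le_pow₀ (n := e) (one_le_two (α := ℝ))]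
  have hXε := mul_rpow_neg_one_div_pow_eq_one hX0 e
  have hε1 : X ^ (-(1 / (2 * (e + 1))) : ℝ) ≤ 1 :=
    Real.rpow_le_one_of_one_le_of_nonpos hX1 (neg_nonpos.2 (by positivity))
  have hε0 : 0 < X ^ (-(1 / (2 * (e + 1))) : ℝ) := by positivity
  generalize X ^ (-(1 / (2 * (e + 1))) : ℝ) = ε at *
  have hXinv : X⁻¹ ≤ ε := by
    rw [inv_le_iff_one_le_mul₀' hX0, ← hXε]
    gcongr
    exact pow_le_of_le_one hε0.le hε1 (by omega)
  have hRt : R ≤ ε * t :=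
    calc R ≤ X⁻¹ * Z := (le_inv_mul_iff₀ hX0).2 hXR
      _ ≤ ε * t := by gcongr
  refine hp.norm_phaseMean_le_mul hε0 hε1 ?_
    (by linarith [(Nat.cast_nonneg M : (0 : ℝ) ≤ M)]) (by linarith) ?_
  · rw [← hXε, hX]
    gcongr
  · refine le_of_mul_le_mul_right ?_ hZ
    calc 2 * C * (t : ℝ) ^ e * |x| * Z ≤ 2 * C * (2 * Z) ^ e * |x| * Z := by gcongr
      _ = X * (2 * C * 2 ^ e) := by rw [hX]; ring
      _ ≤ X * R := by gcongr; linarith [(Nat.cast_nonneg M : (0 : ℝ) ≤ M)]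
      _ ≤ 1 * Z := by rwa [one_mul]

/-- The two-sided decay `min (X ^ p) (X ^ (-p))` of the energy in the scale `X = |x| 2 ^ (n d)` of a
frequency `x`, for `p > 0`. -/
noncomputable def decayProfile (p X : ℝ) : ℝ := if X ≤ 1 then X ^ p else X ^ (-p)

theorem decayProfile_nonneg (p : ℝ) {X : ℝ} (hX : 0 ≤ X) : 0 ≤ decayProfile p X := by
  rw [decayProfile]
  split_ifs <;> positivity

theorem RegularGrowth.dyadicEnergy_phaseMean_le (hp : RegularGrowth p e C M) {X : ℝ}
    (hX : X = |x| * ((2 : ℝ) ^ n) ^ (e + 1)) (hX1 : X ≤ 1) :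
    dyadicEnergy n (fun t => phaseMean p t x) ≤
      14 * (4 * Real.pi * (C * 2 ^ (e + 1))) ^ 2 * √X := by
  have hC : 0 < C := one_pos.trans_le hp.one_le
  have hX0 : 0 ≤ X := hX ▸ by positivity
  have hphase : ∀ m ∈ Set.Icc 1 (2 ^ (n + 1)), |p m * x - p 0 * x| ≤ C * 2 ^ (e + 1) * X := by
    intro m hm
    have hm2 : (m : ℝ) ≤ 2 * 2 ^ n := by
      rw [← pow_succ']
      exact_mod_cast hm.2
    calc |p m * x - p 0 * x| ≤ C * (m : ℝ) ^ (e + 1) * |x| := by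
          rw [← sub_mul, abs_mul]
          gcongr
          exact hp.abs_sub_le m hm.1
      _ ≤ C * (2 * 2 ^ n) ^ (e + 1) * |x| := by gcongr
      _ = C * 2 ^ (e + 1) * X := by rw [hX]; ring
  refine dyadicEnergy_le (by positivity) hX0 (fun t ht t' ht' => ?_) fun t ht t' ht' => ?_
  all_goals
    refine (norm_phaseMean_sub_le hphase ht ht').trans ?_
    rw [← mul_assoc (4 * Real.pi)]
  · rw [mul_right_comm]
    exact mul_le_of_le_one_right (by positivity) hX1
  · exact mul_le_of_le_one_right (by positivity) (abs_sub_div_two_pow_le_one ht ht')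

theorem RegularGrowth.exists_dyadicEnergy_phaseMean_le (hp : RegularGrowth p e C M) :
    ∃ K q : ℝ, 0 < K ∧ 0 < q ∧ ∀ᶠ n : ℕ in atTop, ∀ x X : ℝ,
      X = |x| * ((2 : ℝ) ^ n) ^ (e + 1) → X ≤ ((2 : ℝ) ^ n) ^ (1 / 10 : ℝ) →
        dyadicEnergy n (fun t => phaseMean p t x) ≤ K * decayProfile q X := by
  have hC : 0 < C := one_pos.trans_le hp.one_le
  let B : ℝ := 4 * Real.pi * (C * 2 ^ (e + 1))
  let D : ℝ := 2 * (3 + Real.pi * C)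
  have hD2 : 2 ≤ D := by
    have : 0 < Real.pi * C := by positivity
    linarith
  refine ⟨14 * B ^ 2 + 14 * D ^ 2, 1 / (4 * (e + 1)), by positivity, by positivity, ?_⟩
  filter_upwards [hp.eventually_norm_phaseMean_le] with n hn x X hX hXle
  have hX0 : 0 ≤ X := hX ▸ by positivity
  rw [decayProfile]
  split_ifs with hX1
  · have sqrt_le : √X ≤ X ^ (1 / (4 * (e + 1)) : ℝ) := by
      rw [Real.sqrt_eq_rpow]
      refine Real.rpow_le_rpow_of_exponent_ge' hX0 hX1 (by positivity) ?_
      exact one_div_le_one_div_of_le two_pos (by linarith [(Nat.cast_nonneg e : (0 : ℝ) ≤ e)])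
    calc _ ≤ 14 * B ^ 2 * √X := hp.dyadicEnergy_phaseMean_le hX hX1
      _ ≤ _ := by
        gcongr
        exact le_add_of_nonneg_right (by positivity)
  · have norm_le := hn x X hX (not_le.1 hX1).le hXle
    have sqrt_eq : √(X ^ (-(1 / (2 * (e + 1))) : ℝ)) = X ^ (-(1 / (4 * (e + 1))) : ℝ) := by
      rw [Real.sqrt_eq_rpow, ← Real.rpow_mul hX0]
      congr 1
      field_simp
      norm_num
    calc _ ≤ 14 * D ^ 2 * √(X ^ (-(1 / (2 * (e + 1))) : ℝ)) := by
          refine dyadicEnergy_le (by positivity) (by positivity) (fun t ht t' ht' => ?_)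
            fun t ht t' ht' => ?_
          · refine (norm_phaseMean_sub_le_two_mul p x ht ht').trans ?_
            gcongr
          · exact (norm_sub_le_of_le (norm_le t ht) (norm_le t' ht')).trans_eq (by ring)
      _ ≤ _ := by
        rw [sqrt_eq]
        gcongr
        exact le_add_of_nonneg_left (by positivity)

end PhaseMean

/-! ### Rational frequencies -/

section GaussMean

theorem den_dvd_of_natCast_mul_eq_intCast {r : ℚ} {o : ℕ} {k : ℤ} (ho : o ≠ 0)
    (h : o * r = k) : r.den ∣ o := by
  have hr : r = k * (o : ℚ)⁻¹ := by
    rw [← h]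
    field_simp
  simpa [hr, ho] using Rat.mul_den_dvd k (o : ℚ)⁻¹

theorem den_intCast_mul_le_addOrderOf (b : ℤ) (ρ : ℚ) :
    (b * ρ).den ≤ addOrderOf ((ρ.num * b : ℤ) : ZMod ρ.den) := by
  have : NeZero ρ.den := ⟨ρ.den_nz⟩
  set o := addOrderOf ((ρ.num * b : ℤ) : ZMod ρ.den)
  have ho : 0 < o := addOrderOf_pos _
  have hzero : ((o * (ρ.num * b) : ℤ) : ZMod ρ.den) = 0 := by
    rw [Int.cast_mul, Int.cast_natCast, ← nsmul_eq_mul]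
    exact addOrderOf_nsmul_eq_zero _
  obtain ⟨c, hc⟩ := (ZMod.intCast_zmod_eq_zero_iff_dvd _ _).1 hzero
  refine Nat.le_of_dvd ho (den_dvd_of_natCast_mul_eq_intCast (k := c) ho.ne' ?_)
  have hden : (ρ.den : ℚ) ≠ 0 := by exact_mod_cast ρ.den_nz
  refine mul_left_cancel₀ hden ?_
  calc (ρ.den : ℚ) * (o * (b * ρ)) = o * (ρ * ρ.den * b) := by ring
    _ = ρ.den * c := by rw [Rat.mul_den_eq_num]; exact_mod_cast hc

/-- The normalised complete exponential sum `(1 / q) ∑_{m = 1}^q e(P(m) ρ)` of `P` at a rational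
`ρ` with reduced denominator `q`. -/
noncomputable def gaussMean (P : ℤ[X]) (ρ : ℚ) : ℂ := phaseMean (evalSeq P) ρ.den ρ

theorem fourierChar_evalSeq_mul_rat (P : ℤ[X]) (ρ : ℚ) [NeZero ρ.den] (m : ℕ) :
    (𝐞 (evalSeq P m * ρ) : ℂ) = ZMod.stdAddChar
      (((Polynomial.C ρ.num * P).map (Int.castRingHom (ZMod ρ.den))).eval (m : ZMod ρ.den)) := by
  have heval : ((Polynomial.C ρ.num * P).map (Int.castRingHom (ZMod ρ.den))).eval (m : ZMod ρ.den)
      = ((ρ.num * P.eval (m : ℤ) : ℤ) : ZMod ρ.den) := by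
    simp
  rw [heval, ZMod.stdAddChar_coe, Real.fourierChar_apply, evalSeq, Rat.cast_def]
  congr 1
  push_cast
  ring

theorem sum_range_natCast_zmod {A : Type*} [AddCommMonoid A] {N : ℕ} [NeZero N] (g : ZMod N → A) :
    ∑ i ∈ range N, g ((i + 1 : ℕ) : ZMod N) = ∑ x : ZMod N, g x := by
  rw [← Equiv.sum_comp (Equiv.addRight (1 : ZMod N)) g]
  exact sum_nbij' (fun i => (i : ZMod N)) ZMod.val (by simp) (fun x _ => by simp [ZMod.val_lt x])
    (fun i hi => ZMod.val_cast_of_lt (by simpa using hi)) (by simp) (fun i _ => by simp)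

theorem gaussMean_eq (P : ℤ[X]) (ρ : ℚ) [NeZero ρ.den] :
    gaussMean P ρ = (ρ.den : ℝ)⁻¹ •
      completeSum ((Polynomial.C ρ.num * P).map (Int.castRingHom (ZMod ρ.den))) := by
  rw [gaussMean, phaseMean, natAvg, completeSum, ← sum_range_natCast_zmod]
  simp only [fourierChar_evalSeq_mul_rat]

theorem norm_gaussMean_le_one (P : ℤ[X]) (ρ : ℚ) : ‖gaussMean P ρ‖ ≤ 1 :=
  norm_natAvg_le ρ.den_pos fun _ _ => (Circle.norm_coe _).le

theorem exists_norm_gaussMean_le (P : ℤ[X]) {e : ℕ} (hP : P.natDegree = e + 1) :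
    ∃ κ C : ℝ, 0 < κ ∧ 0 ≤ C ∧ ∀ ρ : ℚ,
      ‖gaussMean P ρ‖ ≤ C * ((P.leadingCoeff * ρ).den : ℝ) ^ (-κ) := by
  obtain ⟨κ, C, hκ, -, hC, hbound⟩ := exists_completeSumBound e
  refine ⟨κ, C, hκ, hC, fun ρ => ?_⟩
  have : NeZero ρ.den := ⟨ρ.den_nz⟩
  set F := (Polynomial.C ρ.num * P).map (Int.castRingHom (ZMod ρ.den)) with hF
  have hdeg : F.natDegree ≤ e + 1 :=
    Polynomial.natDegree_map_le.trans ((Polynomial.natDegree_C_mul_le _ P).trans hP.le)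
  have hcoeff : F.coeff (e + 1) = ((ρ.num * P.leadingCoeff : ℤ) : ZMod ρ.den) := by
    rw [hF, Polynomial.coeff_map, Polynomial.coeff_C_mul, ← hP, Polynomial.coeff_natDegree,
      eq_intCast]
  have hden : (0 : ℝ) < ρ.den := by exact_mod_cast ρ.den_pos
  have horder : (addOrderOf (F.coeff (e + 1)) : ℝ) ^ (-κ)
      ≤ ((P.leadingCoeff * ρ).den : ℝ) ^ (-κ) := by
    refine Real.rpow_le_rpow_of_nonpos (by exact_mod_cast Rat.den_pos _) ?_ (by linarith)
    rw [hcoeff]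
    exact_mod_cast den_intCast_mul_le_addOrderOf P.leadingCoeff ρ
  rw [gaussMean_eq, norm_smul, norm_inv, Real.norm_natCast, inv_mul_le_iff₀ hden]
  calc ‖completeSum F‖ ≤ C * ρ.den * (addOrderOf (F.coeff (e + 1)) : ℝ) ^ (-κ) := hbound _ F hdeg
    _ ≤ C * ρ.den * ((P.leadingCoeff * ρ).den : ℝ) ^ (-κ) := by gcongr
    _ = ρ.den * (C * ((P.leadingCoeff * ρ).den : ℝ) ^ (-κ)) := by ring

variable {P : ℤ[X]} {e M n : ℕ} {C x : ℝ} {ρ : ℚ}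

theorem norm_phaseMean_sub_gaussMean_mul_le {t : ℕ} {D : ℝ} (ht : 0 < t) (hD0 : 0 ≤ D)
    (hD : ∀ m ∈ Set.Ico 1 t, |evalSeq P (m + 1) - evalSeq P m| * |x - ρ| ≤ D) :
    ‖phaseMean (evalSeq P) t x - gaussMean P ρ * phaseMean (evalSeq P) t (x - ρ)‖ ≤
      2 * ρ.den * (1 + t * (2 * Real.pi * D)) / t := by
  have : NeZero ρ.den := ⟨ρ.den_nz⟩
  have hsplit : phaseMean (evalSeq P) t x = natAvg (fun m =>
      (𝐞 (evalSeq P m * ρ) : ℂ) * (𝐞 (evalSeq P m * (x - ρ)) : ℂ)) t := by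
    simp only [← Circle.coe_mul, ← AddChar.map_add_eq_mul, ← mul_add, add_sub_cancel, phaseMean]
  rw [hsplit]
  refine norm_natAvg_mul_sub_le_of_periodic ρ.den_pos ht (fun m => ?_)
    (fun m => (Circle.norm_coe _).le) (Circle.norm_coe _).le (fun m hm => ?_) (by positivity)
  · simp only [fourierChar_evalSeq_mul_rat, Nat.cast_add, CharP.cast_eq_zero, zero_add]
  · refine (norm_fourierChar_sub_le _ _).trans ?_
    rw [← sub_mul, abs_mul]
    gcongr
    exact hD m hm

theorem RegularGrowth.norm_phaseMean_sub_gaussMean_mul_le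
    (hp : RegularGrowth (evalSeq P) e C M) {c Q : ℝ} (hc : 0 ≤ c) (hQ : 1 ≤ Q)
    (hden : ρ.den ≤ c * Q) (hx : |x - ρ| * ((2 : ℝ) ^ n) ^ (e + 1) ≤ Q) {t : ℕ}
    (ht : t ∈ Set.Icc (2 ^ n) (2 ^ (n + 1))) :
    ‖phaseMean (evalSeq P) t x - gaussMean P ρ * phaseMean (evalSeq P) t (x - ρ)‖ ≤
      2 * c * (1 + Real.pi * C * 2 ^ (e + 2)) * (Q ^ 2 / 2 ^ n) := by
  have hC : 0 < C := one_pos.trans_le hp.one_le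
  set Z : ℝ := 2 ^ n with hZ
  have hZ0 : 0 < Z := by positivity
  have htZ : Z ≤ t := by
    rw [hZ]
    exact_mod_cast ht.1
  have htZ2 : (t : ℝ) ≤ 2 * Z := by
    rw [hZ, ← pow_succ']
    exact_mod_cast ht.2
  have hbound := PolyVariation.norm_phaseMean_sub_gaussMean_mul_le (x := x) (ρ := ρ)
    (t := t) (D := C * (2 * Z) ^ e * |x - ρ|) (by exact_mod_cast hZ0.trans_le htZ) (by positivity)
    fun m hm => by
      have hmt : (m : ℝ) ≤ 2 * Z := le_trans (by exact_mod_cast hm.2.le) htZ2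
      exact mul_le_mul_of_nonneg_right ((hp.abs_diff_le m hm.1).trans (by gcongr)) (abs_nonneg _)
  have hvar : t * (2 * Real.pi * (C * (2 * Z) ^ e * |x - ρ|)) ≤ Real.pi * C * 2 ^ (e + 2) * Q :=
    calc t * (2 * Real.pi * (C * (2 * Z) ^ e * |x - ρ|))
        ≤ 2 * Z * (2 * Real.pi * (C * (2 * Z) ^ e * |x - ρ|)) := by gcongr
      _ = Real.pi * C * 2 ^ (e + 2) * (|x - ρ| * Z ^ (e + 1)) := by
        rw [mul_pow]
        ring
      _ ≤ Real.pi * C * 2 ^ (e + 2) * Q := by gcongr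
  calc _ ≤ 2 * ρ.den * (1 + t * (2 * Real.pi * (C * (2 * Z) ^ e * |x - ρ|))) / t := hbound
    _ ≤ 2 * (c * Q) * (Q + Real.pi * C * 2 ^ (e + 2) * Q) / Z := by gcongr
    _ = 2 * c * (1 + Real.pi * C * 2 ^ (e + 2)) * (Q ^ 2 / Z) := by ring

end GaussMean

section Energy

variable {p : ℕ → ℝ} {n : ℕ} {x η : ℝ} {S : ℂ}

theorem dyadicEnergy_phaseMean_sub_le {B W : ℝ} (hB : 0 ≤ B) (hW : 0 ≤ W) (hS : ‖S‖ ≤ 1)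
    (happrox : ∀ t ∈ Set.Icc (2 ^ n) (2 ^ (n + 1)),
      ‖phaseMean p t x - S * phaseMean p t η‖ ≤ B * W) :
    dyadicEnergy n (fun t => phaseMean p t x - S * phaseMean p t η) ≤
      14 * (4 + 2 * B) ^ 2 * √W := by
  refine dyadicEnergy_le (by positivity) hW (fun t ht t' ht' => ?_) (fun t ht t' ht' => ?_)
  · have hx := norm_phaseMean_sub_le_two_mul p x ht ht'
    have hη : ‖S * (phaseMean p t η - phaseMean p t' η)‖ ≤ 1 * (2 * (|(t : ℝ) - t'| / 2 ^ n)) := by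
      rw [norm_mul]
      gcongr
      exact norm_phaseMean_sub_le_two_mul p η ht ht'
    have hnonneg : 0 ≤ 2 * B * (|(t : ℝ) - t'| / 2 ^ n) := by positivity
    rw [sub_sub_sub_comm, ← mul_sub]
    refine (norm_sub_le _ _).trans ?_
    linarith
  · refine (norm_sub_le _ _).trans ?_
    linarith [happrox t ht, happrox t' ht']

theorem dyadicEnergy_phaseMean_le_of_norm_sub_le {B W : ℝ} (hB : 0 ≤ B) (hW : 0 ≤ W)
    (hS : ‖S‖ ≤ 1) (happrox : ∀ t ∈ Set.Icc (2 ^ n) (2 ^ (n + 1)),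
      ‖phaseMean p t x - S * phaseMean p t η‖ ≤ B * W) :
    dyadicEnergy n (fun t => phaseMean p t x) ≤
      2 * (‖S‖ ^ 2 * dyadicEnergy n (fun t => phaseMean p t η)) + 28 * (4 + 2 * B) ^ 2 * √W := by
  have hsplit := dyadicEnergy_add_le n (fun t => S • phaseMean p t η)
    (fun t => phaseMean p t x - S * phaseMean p t η)
  rw [dyadicEnergy_smul] at hsplit
  simp only [smul_eq_mul, add_sub_cancel] at hsplit
  linarith [dyadicEnergy_phaseMean_sub_le hB hW hS happrox]

end Energy

/-! ### Major arcs -/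

section MajorArcs

/-- The distance from `b_d α` to `r` that enters the definition of the major arc at `r`. -/
noncomputable def arcDist (P : ℤ[X]) (α : UnitAddCircle) (r : ℚ) : ℝ :=
  if r = 0 then ‖P.leadingCoeff • α‖ else |circleFract (P.leadingCoeff • α) - (r : ℝ)|

/-- The fractions of level `s` whose distance to `b_d α` is below half the minimal spacing
`4 ^ (-(s + 1))` of the level. -/
def nearLevel (P : ℤ[X]) (α : UnitAddCircle) (s : ℕ) : Set ℚ :=
  {r ∈ rationalLevel s | arcDist P α r * (2 * 4 ^ (s + 1)) < 1}

theorem exists_abs_sub_eq_arcDist (P : ℤ[X]) (x : ℝ) (r : ℚ) :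
    ∃ k : ℤ, |P.leadingCoeff * x - (r + k)| = arcDist P x r := by
  have hcoe : P.leadingCoeff • (x : UnitAddCircle)
      = ((P.leadingCoeff * x : ℝ) : UnitAddCircle) := by
    rw [← zsmul_eq_mul, AddCircle.coe_zsmul]
  rw [arcDist, hcoe]
  split_ifs with hr
  · refine ⟨round (P.leadingCoeff * x), ?_⟩
    rw [UnitAddCircle.norm_eq, hr, Rat.cast_zero, zero_add]
  · refine ⟨⌊P.leadingCoeff * x⌋, ?_⟩
    rw [circleFract_coe, Int.fract, sub_sub, add_comm]

theorem exists_rat_abs_sub_eq_arcDist {P : ℤ[X]} (hP : P ≠ 0) (x : ℝ) (r : ℚ) :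
    ∃ ρ : ℚ, (P.leadingCoeff * ρ).den = r.den ∧ ρ.den ≤ |(P.leadingCoeff : ℝ)| * r.den ∧
      |(P.leadingCoeff : ℝ)| * |x - ρ| = arcDist P x r := by
  obtain ⟨k, hk⟩ := exists_abs_sub_eq_arcDist P x r
  have hb : P.leadingCoeff ≠ 0 := Polynomial.leadingCoeff_ne_zero.2 hP
  have hbQ : (P.leadingCoeff : ℚ) ≠ 0 := by exact_mod_cast hb
  have hbR : (P.leadingCoeff : ℝ) ≠ 0 := by exact_mod_cast hb
  refine ⟨(r + k) * (P.leadingCoeff : ℚ)⁻¹, ?_, ?_, ?_⟩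
  · rw [mul_comm, inv_mul_cancel_right₀ hbQ, Rat.add_intCast_den]
  · have hdvd := Rat.mul_den_dvd (r + k) (P.leadingCoeff : ℚ)⁻¹
    rw [Rat.add_intCast_den, Rat.inv_intCast_den, if_neg hb, mul_comm r.den] at hdvd
    have := Nat.le_of_dvd (Nat.mul_pos (Int.natAbs_pos.2 hb) r.den_pos) hdvd
    rw [← Int.cast_abs, Int.abs_eq_natAbs]
    exact_mod_cast this
  · rw [← abs_mul, ← hk]
    push_cast
    congr 1
    field_simp

theorem eq_zero_of_abs_mul_den_lt_one {z : ℚ} (hz : |z| * z.den < 1) : z = 0 := by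
  rw [← Nat.abs_cast, ← abs_mul, Rat.mul_den_eq_num] at hz
  exact Rat.num_eq_zero.1 (Int.abs_lt_one_iff.1 (by exact_mod_cast hz))

theorem eq_of_abs_sub_add_intCast_lt {r r' : ℚ} {j : ℤ} (hr : r ∈ Set.Ico 0 1)
    (hr' : r' ∈ Set.Ico 0 1) (h : |r - r' + j| * (r.den * r'.den) < 1) : r = r' := by
  have hden : (r - r' + j).den ≤ r.den * r'.den := by
    rw [Rat.add_intCast_den]
    exact Nat.le_of_dvd (Nat.mul_pos r.den_pos r'.den_pos) (Rat.sub_den_dvd r r')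
  have hzero : r - r' + j = 0 := eq_zero_of_abs_mul_den_lt_one <| h.trans_le' <| by
    gcongr
    exact_mod_cast hden
  have hj : |(j : ℚ)| < 1 := by
    rw [abs_lt]
    constructor <;> linarith [hr.1, hr.2, hr'.1, hr'.2]
  have hj0 : j = 0 := Int.abs_lt_one_iff.1 (by exact_mod_cast hj)
  rw [hj0, Int.cast_zero] at hzero
  linarith

theorem nearLevel_subsingleton (P : ℤ[X]) (x : ℝ) (s : ℕ) :
    (nearLevel P x s).Subsingleton := by
  rintro r ⟨⟨hr0, hr1, -, hden⟩, hr⟩ r' ⟨⟨hr0', hr1', -, hden'⟩, hr'⟩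
  obtain ⟨k, hk⟩ := exists_abs_sub_eq_arcDist P x r
  obtain ⟨k', hk'⟩ := exists_abs_sub_eq_arcDist P x r'
  refine eq_of_abs_sub_add_intCast_lt (j := k - k') ⟨hr0, hr1⟩ ⟨hr0', hr1'⟩ ?_
  have hdist : |(r - r' + (k - k') : ℝ)| ≤ arcDist P x r' + arcDist P x r := by
    rw [← hk, ← hk']
    refine le_trans (le_of_eq ?_) (abs_sub _ _)
    congr 1
    ring
  have hdens : (r.den * r'.den : ℝ) ≤ 4 ^ (s + 1) := by
    calc (r.den * r'.den : ℝ) ≤ 2 ^ (s + 1) * 2 ^ (s + 1) := by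
          gcongr <;> exact_mod_cast Nat.le_of_lt ‹_›
      _ = 4 ^ (s + 1) := by rw [← mul_pow]; norm_num
  have hdist0 : 0 ≤ arcDist P x r' + arcDist P x r := (abs_nonneg _).trans hdist
  have hlt : |(r - r' + (k - k') : ℝ)| * (r.den * r'.den) < 1 := by
    calc |(r - r' + (k - k') : ℝ)| * (r.den * r'.den)
        ≤ (arcDist P x r' + arcDist P x r) * 4 ^ (s + 1) := by gcongr
      _ < 1 := by linarith
  exact_mod_cast hlt

variable {P : ℤ[X]} {e n s : ℕ} {δ : ℝ}

theorem den_le_of_mem_rationalLevel {κ : ℝ} {r : ℚ} (hδ : δ ≤ κ) (hs : s ≤ n * δ)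
    (hr : r ∈ rationalLevel s) : r.den ≤ 2 * ((2 : ℝ) ^ n) ^ κ := by
  have hlevel : (2 : ℝ) ^ s ≤ ((2 : ℝ) ^ n) ^ κ := by
    rw [← Real.rpow_natCast 2 n, ← Real.rpow_natCast 2 s, ← Real.rpow_mul zero_le_two]
    exact Real.rpow_le_rpow_of_exponent_le one_le_two (hs.trans (by gcongr))
  calc (r.den : ℝ) ≤ 2 * 2 ^ s := by
        rw [← pow_succ']
        exact_mod_cast hr.2.2.2.le
    _ ≤ 2 * ((2 : ℝ) ^ n) ^ κ := by gcongr

theorem two_rpow_mul_two_pow_pow_le {κ : ℝ} {d : ℕ} (hδ : δ ≤ κ) :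
    (2 : ℝ) ^ (-((n : ℝ) * (d - δ))) * ((2 : ℝ) ^ n) ^ d ≤ ((2 : ℝ) ^ n) ^ κ := by
  rw [← pow_mul, ← Real.rpow_natCast 2 (n * d), ← Real.rpow_natCast 2 n,
    ← Real.rpow_mul zero_le_two, ← Real.rpow_add two_pos]
  refine Real.rpow_le_rpow_of_exponent_le one_le_two ?_
  push_cast
  nlinarith [mul_le_mul_of_nonneg_left hδ (Nat.cast_nonneg (α := ℝ) n)]

theorem mem_nearLevel_of_arcDist_lt {α : UnitAddCircle} {r : ℚ} (hd : 1 ≤ P.natDegree)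
    (hδ : δ < 1 / 10) (hn : 5 ≤ n) (hs : s ≤ n * δ) (hr : r ∈ rationalLevel s)
    (harc : arcDist P α r < (2 : ℝ) ^ (-((n : ℝ) * (P.natDegree - δ)))) :
    r ∈ nearLevel P α s := by
  refine ⟨hr, ?_⟩
  have hn' : (5 : ℝ) ≤ n := by exact_mod_cast hn
  have hd' : (1 : ℝ) ≤ P.natDegree := by exact_mod_cast hd
  have hspacing : (2 * 4 ^ (s + 1) : ℝ) = (2 : ℝ) ^ (2 * (s : ℝ) + 3) := by
    rw [show (4 : ℝ) = 2 ^ 2 by norm_num, ← pow_mul, ← pow_succ', ← Real.rpow_natCast]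
    push_cast
    ring_nf
  calc arcDist P α r * (2 * 4 ^ (s + 1))
      < (2 : ℝ) ^ (-((n : ℝ) * (P.natDegree - δ))) * (2 : ℝ) ^ (2 * (s : ℝ) + 3) := by
        rw [hspacing]
        gcongr
    _ = (2 : ℝ) ^ (-((n : ℝ) * (P.natDegree - δ)) + (2 * s + 3)) := (Real.rpow_add two_pos _ _).symm
    _ ≤ 1 := Real.rpow_le_one_of_one_le_of_nonpos one_le_two (by nlinarith)

theorem RegularGrowth.dyadicEnergy_phaseMean_le_gaussMean {C c x : ℝ} {M : ℕ} {ρ : ℚ}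
    (hp : RegularGrowth (evalSeq P) e C M) (hc : 0 ≤ c)
    (hden : ρ.den ≤ c * ((2 : ℝ) ^ n) ^ (1 / 10 : ℝ))
    (hx : |x - ρ| * ((2 : ℝ) ^ n) ^ (e + 1) ≤ ((2 : ℝ) ^ n) ^ (1 / 10 : ℝ)) :
    dyadicEnergy n (fun t => phaseMean (evalSeq P) t x) ≤
      2 * (‖gaussMean P ρ‖ ^ 2 * dyadicEnergy n (fun t => phaseMean (evalSeq P) t (x - ρ))) +
      28 * (4 + 2 * (2 * c * (1 + Real.pi * C * 2 ^ (e + 2)))) ^ 2 *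
        ((2 : ℝ) ^ (-(2 / 5) : ℝ)) ^ n := by
  have hC : 0 < C := one_pos.trans_le hp.one_le
  have hQ : 1 ≤ ((2 : ℝ) ^ n) ^ (1 / 10 : ℝ) :=
    Real.one_le_rpow (one_le_pow₀ one_le_two) (by norm_num)
  have herror : √((((2 : ℝ) ^ n) ^ (1 / 10 : ℝ)) ^ 2 / 2 ^ n) = ((2 : ℝ) ^ (-(2 / 5) : ℝ)) ^ n := by
    rw [Real.sqrt_eq_rpow, ← Real.rpow_natCast 2 n, ← Real.rpow_mul zero_le_two,
      ← Real.rpow_mul_natCast zero_le_two, ← Real.rpow_sub two_pos, ← Real.rpow_mul zero_le_two,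
      ← Real.rpow_mul_natCast zero_le_two]
    ring_nf
  rw [← herror]
  exact dyadicEnergy_phaseMean_le_of_norm_sub_le (by positivity) (by positivity)
    (norm_gaussMean_le_one P ρ) fun t ht => hp.norm_phaseMean_sub_gaussMean_mul_le hc hQ hden hx ht

theorem exists_norm_gaussMean_sq_le_of_rationalLevel (hd : P.natDegree = e + 1) :
    ∃ G τ : ℝ, 0 ≤ G ∧ 0 ≤ τ ∧ τ < 1 ∧ ∀ (s : ℕ) (r ρ : ℚ), r ∈ rationalLevel s →
      (P.leadingCoeff * ρ).den = r.den → ‖gaussMean P ρ‖ ^ 2 ≤ G * τ ^ s := by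
  obtain ⟨κ, G, hκ, hG, hgauss⟩ := exists_norm_gaussMean_le P hd
  refine ⟨G ^ 2, (2 : ℝ) ^ (-(2 * κ)), by positivity, by positivity,
    Real.rpow_lt_one_of_one_lt_of_neg one_lt_two (by linarith), fun s r ρ hr hρ => ?_⟩
  have hlevel : (r.den : ℝ) ^ (-κ) ≤ ((2 : ℝ) ^ s) ^ (-κ) :=
    Real.rpow_le_rpow_of_nonpos (by positivity) (by exact_mod_cast hr.2.2.1) (neg_nonpos.2 hκ.le)
  calc ‖gaussMean P ρ‖ ^ 2 ≤ (G * (r.den : ℝ) ^ (-κ)) ^ 2 := by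
        gcongr
        rw [← hρ]
        exact hgauss ρ
    _ ≤ (G * ((2 : ℝ) ^ s) ^ (-κ)) ^ 2 :=
        pow_le_pow_left₀ (by positivity) (mul_le_mul_of_nonneg_left hlevel hG) 2
    _ = G ^ 2 * ((2 : ℝ) ^ (-(2 * κ))) ^ s := by
        rw [mul_pow, ← Real.rpow_natCast 2 s, ← Real.rpow_mul zero_le_two,
          ← Real.rpow_mul_natCast zero_le_two, ← Real.rpow_mul_natCast zero_le_two]
        ring_nf

theorem exists_dyadicEnergy_le_of_arcDist_lt (hd : P.natDegree = e + 1) (hδ : δ < 1 / 10) :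
    ∃ K q τ σ : ℝ, 0 ≤ K ∧ 0 < q ∧ 0 ≤ τ ∧ τ < 1 ∧ 0 ≤ σ ∧ σ < 1 ∧ ∀ᶠ n : ℕ in atTop,
      ∀ (s : ℕ) (r : ℚ), s ≤ n * δ → r ∈ rationalLevel s → ∀ x : ℝ,
        arcDist P x r < (2 : ℝ) ^ (-((n : ℝ) * (P.natDegree - δ))) →
        dyadicEnergy n (fun t => phaseMean (evalSeq P) t x) ≤
          K * (τ ^ s * decayProfile q (arcDist P x r / |(P.leadingCoeff : ℝ)| *
            ((2 : ℝ) ^ n) ^ (e + 1)) + σ ^ n) := by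
  obtain ⟨C, M, hp⟩ := exists_regularGrowth_evalSeq hd
  obtain ⟨G, τ, hG, hτ0, hτ1, hgauss⟩ := exists_norm_gaussMean_sq_le_of_rationalLevel hd
  obtain ⟨K, q, hK, hq, hosc⟩ := hp.exists_dyadicEnergy_phaseMean_le
  have hP : P ≠ 0 := Polynomial.ne_zero_of_natDegree_gt (n := 0) (by omega)
  have hb : 1 ≤ |(P.leadingCoeff : ℝ)| := by
    exact_mod_cast Int.one_le_abs (Polynomial.leadingCoeff_ne_zero.2 hP)
  set b : ℝ := |(P.leadingCoeff : ℝ)|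
  set H : ℝ := 28 * (4 + 2 * (2 * (2 * b) * (1 + Real.pi * C * 2 ^ (e + 2)))) ^ 2
  have : 0 ≤ H := by positivity
  refine ⟨2 * G * K + H, q, τ, (2 : ℝ) ^ (-(2 / 5) : ℝ), by positivity, hq, hτ0, hτ1, by positivity,
    Real.rpow_lt_one_of_one_lt_of_neg one_lt_two (by norm_num), ?_⟩
  filter_upwards [hosc] with n hosc s r hs hr x harc
  obtain ⟨ρ, hρ, hden, hdist⟩ := exists_rat_abs_sub_eq_arcDist hP x r
  have hscale : arcDist P x r / b = |x - ρ| := by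
    rw [← hdist, mul_div_cancel_left₀ _ (by positivity)]
  have hnear : |x - ρ| * ((2 : ℝ) ^ n) ^ (e + 1) ≤ ((2 : ℝ) ^ n) ^ (1 / 10 : ℝ) := by
    refine le_trans ?_ (two_rpow_mul_two_pow_pow_le (n := n) (d := e + 1) hδ.le)
    gcongr
    rw [← hd]
    exact (le_mul_of_one_le_left (abs_nonneg _) hb).trans (hdist.trans_le harc.le)
  have hden' : ρ.den ≤ 2 * b * ((2 : ℝ) ^ n) ^ (1 / 10 : ℝ) := by
    rw [mul_comm 2 b, mul_assoc]
    exact hden.trans (mul_le_mul_of_nonneg_left (den_le_of_mem_rationalLevel hδ.le hs hr)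
      (by positivity))
  have henergy := hp.dyadicEnergy_phaseMean_le_gaussMean (by positivity) hden' hnear
  rw [hscale]
  set D : ℝ := decayProfile q (|x - ρ| * ((2 : ℝ) ^ n) ^ (e + 1))
  have hD : 0 ≤ D := decayProfile_nonneg q (by positivity)
  have hmain := mul_le_mul (hgauss s r ρ hr hρ) (hosc _ _ rfl hnear) (dyadicEnergy_nonneg _ _)
    (by positivity)
  have hcross : 0 ≤ H * (τ ^ s * D) + 2 * G * K * ((2 : ℝ) ^ (-(2 / 5) : ℝ)) ^ n := by positivity
  linarith

end MajorArcs

/-! ### Summation over scales -/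

section SumOverScales

theorem decayProfile_two_rpow (p w : ℝ) : decayProfile p ((2 : ℝ) ^ w) = 2 ^ (-(p * |w|)) := by
  rw [decayProfile]
  split_ifs with hle
  · have hw : w ≤ 0 := by simpa [Real.rpow_le_one_iff_of_pos two_pos] using hle
    rw [← Real.rpow_mul zero_le_two, abs_of_nonpos hw]
    ring_nf
  · have hw : 0 ≤ w := by
      contrapose! hle
      exact Real.rpow_le_one_of_one_le_of_nonpos one_le_two hle.le
    rw [← Real.rpow_mul zero_le_two, abs_of_nonneg hw]
    ring_nf

theorem decayProfile_two_rpow_le {p : ℝ} (hp : 0 ≤ p) {w : ℝ} {j : ℤ} (hj : |w - j| ≤ 1) :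
    decayProfile p ((2 : ℝ) ^ w) ≤ 2 ^ p * ((2 : ℝ) ^ (-p)) ^ j.natAbs := by
  have hnatAbs : (j.natAbs : ℝ) ≤ |w| + 1 := by
    rw [Nat.cast_natAbs, Int.cast_abs]
    linarith [abs_sub_abs_le_abs_sub (j : ℝ) w, abs_sub_comm w j]
  rw [decayProfile_two_rpow, ← Real.rpow_mul_natCast zero_le_two, ← Real.rpow_add two_pos]
  exact Real.rpow_le_rpow_of_exponent_le one_le_two (by nlinarith)

theorem exists_tsum_decayProfile_le {p : ℝ} (hp : 0 < p) {k : ℕ} (hk : k ≠ 0) :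
    ∃ C : ℝ≥0, ∀ β : ℝ, 0 ≤ β →
      ∑' n : ℕ, ENNReal.ofReal (decayProfile p (β * ((2 : ℝ) ^ n) ^ k)) ≤ C := by
  let σ : ℝ := (2 : ℝ) ^ (-p)
  have hσ : Summable fun j : ℕ => σ ^ j := summable_geometric_of_lt_one (by positivity)
    (Real.rpow_lt_one_of_one_lt_of_neg one_lt_two (by linarith))
  have hsum : Summable fun j : ℤ => (2 : ℝ) ^ p * σ ^ j.natAbs :=
    Summable.mul_left _ (Summable.of_nat_of_neg (by simpa using hσ) (by simpa using hσ))
  refine ⟨(∑' j : ℤ, ENNReal.ofReal ((2 : ℝ) ^ p * σ ^ j.natAbs)).toNNReal, fun β hβ => ?_⟩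
  rw [ENNReal.coe_toNNReal hsum.tsum_ofReal_ne_top]
  rcases hβ.eq_or_lt with rfl | hβ0
  · simp [decayProfile, Real.zero_rpow hp.ne']
  let y : ℝ := Real.logb 2 β
  have hinj : Function.Injective fun n : ℕ => ⌊y⌋ + (n : ℤ) * k := fun n m h => by
    simpa [hk] using h
  refine le_trans (ENNReal.tsum_le_tsum fun n => ENNReal.ofReal_le_ofReal ?_)
    (ENNReal.tsum_comp_le_tsum_of_injective hinj _)
  have hscale : β * ((2 : ℝ) ^ n) ^ k = (2 : ℝ) ^ (y + n * k) := by
    rw [Real.rpow_add two_pos, Real.rpow_logb two_pos (by norm_num) hβ0, ← pow_mul,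
      ← Real.rpow_natCast, Nat.cast_mul]
  rw [hscale]
  refine decayProfile_two_rpow_le hp.le ?_
  push_cast
  rw [add_sub_add_right_eq_sub, Int.self_sub_floor, abs_of_nonneg (Int.fract_nonneg y)]
  exact (Int.fract_lt_one y).le

theorem tsum_le_natCast_mul_add_tsum {f g : ℕ → ℝ≥0∞} {B : ℝ≥0∞} {N : ℕ} (hf : ∀ n, f n ≤ B)
    (hfg : ∀ n, N ≤ n → f n ≤ g n) : ∑' n, f n ≤ N * B + ∑' n, g n := by
  have hhead : ∑ n ∈ range N, f n ≤ N * B := by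
    simpa using sum_le_sum fun n (_ : n ∈ range N) => hf n
  have htail : ∑' n, f (n + N) ≤ ∑' n, g n :=
    (ENNReal.tsum_le_tsum fun n => hfg (n + N) (Nat.le_add_left N n)).trans
      (ENNReal.tsum_comp_le_tsum_of_injective (f := fun n => n + N) (add_left_injective N) g)
  rw [← ENNReal.summable.sum_add_tsum_nat_add' (f := f) (k := N)]
  exact add_le_add hhead htail

theorem tsum_subtype_le_of_subsingleton {ι : Type*} {s : Set ι} (hs : s.Subsingleton)
    {f : s → ℝ≥0∞} {B : ℝ≥0∞} (hf : ∀ i, f i ≤ B) : ∑' i, f i ≤ B := by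
  have := hs.coe_sort
  rcases isEmpty_or_nonempty s with _ | ⟨⟨i⟩⟩
  · simp
  · rw [tsum_eq_single i fun j hj => (hj (Subsingleton.elim j i)).elim]
    exact hf i

/-- The Fourier multiplier `α ↦ (1 / t) ∑_{m = 1}^t e(P(m) α)` of the polynomial mean over `t`
terms. -/
noncomputable def multiplier (P : ℤ[X]) (t : ℕ) (α : UnitAddCircle) : ℂ :=
  natAvg (fun m => (fourier (P.eval (m : ℤ)) α : ℂ)) t

theorem multiplier_coe (P : ℤ[X]) (t : ℕ) (x : ℝ) :
    multiplier P t x = phaseMean (evalSeq P) t x := by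
  rw [multiplier, phaseMean]
  congr 1
  funext m
  rw [fourier_coe_apply, Real.fourierChar_apply, evalSeq]
  congr 1
  push_cast
  ring

variable {P : ℤ[X]} {δ : ℝ}

theorem dyadicEnergy_multiplier_eq_zero (hP : P.natDegree = 0) (n : ℕ) (α : UnitAddCircle) :
    dyadicEnergy n (fun t => multiplier P t α) = 0 := by
  induction α using QuotientAddGroup.induction_on with | _ x
  have hdiff : ∀ t ∈ Set.Icc (2 ^ n) (2 ^ (n + 1)), ∀ t' ∈ Set.Icc (2 ^ n) (2 ^ (n + 1)),
      ‖multiplier P t x - multiplier P t' x‖ = 0 := fun t ht t' ht' => by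
    rw [multiplier_coe, multiplier_coe]
    refine le_antisymm ((norm_phaseMean_sub_le (B := 0) (c := P.coeff 0 * x) (fun m _ => ?_)
      ht ht').trans_eq (by ring)) (norm_nonneg _)
    rw [Polynomial.eq_C_of_natDegree_eq_zero hP]
    simp [evalSeq]
  refine le_antisymm ((dyadicEnergy_le (K := 0) le_rfl zero_le_one (fun t ht t' ht' => ?_)
    fun t ht t' ht' => ?_).trans_eq (by ring)) (dyadicEnergy_nonneg _ _)
  all_goals rw [hdiff t ht t' ht', zero_mul]

theorem exists_indicator_dyadicEnergy_le {e : ℕ} (hd : P.natDegree = e + 1) (hδ : δ < 1 / 10) :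
    ∃ K q τ σ : ℝ, 0 < q ∧ (Summable fun s : ℕ => K * τ ^ s) ∧ (Summable fun n : ℕ => K * σ ^ n) ∧
      ∀ᶠ n : ℕ in atTop, ∀ x : ℝ, (majorArcs P δ n).indicator
        (fun α => ENNReal.ofReal (dyadicEnergy n (fun t => multiplier P t α))) x ≤
      ∑' (s : ℕ) (r : nearLevel P x s), ENNReal.ofReal (K * τ ^ s) *
        ENNReal.ofReal (decayProfile q
          (arcDist P x r / |(P.leadingCoeff : ℝ)| * ((2 : ℝ) ^ n) ^ (e + 1))) +
      ENNReal.ofReal (K * σ ^ n) := by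
  obtain ⟨K, q, τ, σ, hK, hq, hτ0, hτ1, hσ0, hσ1, hmain⟩ :=
    exists_dyadicEnergy_le_of_arcDist_lt hd hδ
  refine ⟨K, q, τ, σ, hq, (summable_geometric_of_lt_one hτ0 hτ1).mul_left K,
    (summable_geometric_of_lt_one hσ0 hσ1).mul_left K, ?_⟩
  filter_upwards [hmain, eventually_ge_atTop 5] with n hmain hn x
  refine Set.indicator_apply_le' (fun hx => ?_) fun _ => zero_le
  simp only [majorArcs, Set.mem_iUnion, exists_prop] at hx
  obtain ⟨s, hs, r, hr, harc⟩ := hx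
  have hnear : r ∈ nearLevel P x s := mem_nearLevel_of_arcDist_lt (by omega) hδ hn hs hr harc
  have henergy := ENNReal.ofReal_le_ofReal (hmain s r hs hr x harc)
  rw [mul_add, ← mul_assoc] at henergy
  simp only [multiplier_coe]
  refine henergy.trans (ENNReal.ofReal_add_le.trans ?_)
  rw [ENNReal.ofReal_mul (by positivity)]
  gcongr
  refine le_trans ?_ (ENNReal.le_tsum s)
  exact ENNReal.le_tsum (f := fun r : nearLevel P x s => ENNReal.ofReal (K * τ ^ s) *
    ENNReal.ofReal (decayProfile q
      (arcDist P x r / |(P.leadingCoeff : ℝ)| * ((2 : ℝ) ^ n) ^ (e + 1)))) ⟨r, hnear⟩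

theorem exists_tsum_dyadicEnergy_multiplier_le_of_natDegree {e : ℕ} (hd : P.natDegree = e + 1)
    (hδ : δ < 1 / 10) :
    ∃ C : ℝ≥0, ∀ α : UnitAddCircle, ∑' n : ℕ, (majorArcs P δ n).indicator
      (fun α => ENNReal.ofReal (dyadicEnergy n (fun t => multiplier P t α))) α ≤ C := by
  obtain ⟨K, q, τ, σ, hq, hτ, hσ, hmain⟩ := exists_indicator_dyadicEnergy_le hd hδ
  obtain ⟨N, hN⟩ := eventually_atTop.1 hmain
  obtain ⟨C, hC⟩ := exists_tsum_decayProfile_le hq e.succ_ne_zero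
  let B : ℝ≥0∞ := N * 56 + (∑' s : ℕ, ENNReal.ofReal (K * τ ^ s) * C +
    ∑' n : ℕ, ENNReal.ofReal (K * σ ^ n))
  have hB : B ≠ ∞ := by
    rw [ENNReal.add_ne_top, ENNReal.add_ne_top, ENNReal.tsum_mul_right]
    exact ⟨ENNReal.mul_ne_top (ENNReal.natCast_ne_top N) (by norm_num),
      ENNReal.mul_ne_top hτ.tsum_ofReal_ne_top ENNReal.coe_ne_top, hσ.tsum_ofReal_ne_top⟩
  refine ⟨B.toNNReal, fun α => ?_⟩
  induction α using QuotientAddGroup.induction_on with | _ x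
  rw [ENNReal.coe_toNNReal hB]
  refine (tsum_le_natCast_mul_add_tsum (B := 56) (fun n => ?_) fun n hn => hN n hn x).trans ?_
  · refine Set.indicator_apply_le' (fun _ => ?_) fun _ => zero_le
    simp only [multiplier_coe]
    exact (ENNReal.ofReal_le_ofReal (dyadicEnergy_phaseMean_le _ n x)).trans (by norm_num)
  · rw [ENNReal.tsum_add, ENNReal.tsum_comm]
    refine add_le_add_right (add_le_add_left (ENNReal.tsum_le_tsum fun s => ?_) _) _
    rw [ENNReal.tsum_comm]
    refine tsum_subtype_le_of_subsingleton (nearLevel_subsingleton P x s) fun r => ?_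
    rw [ENNReal.tsum_mul_left]
    gcongr
    refine hC _ (div_nonneg ?_ (abs_nonneg _))
    obtain ⟨k, hk⟩ := exists_abs_sub_eq_arcDist P x r
    exact hk ▸ abs_nonneg _

theorem exists_tsum_dyadicEnergy_multiplier_le (P : ℤ[X]) (hδ : δ < 1 / 10) :
    ∃ C : ℝ≥0, ∀ α : UnitAddCircle, ∑' n : ℕ, (majorArcs P δ n).indicator
      (fun α => ENNReal.ofReal (dyadicEnergy n (fun t => multiplier P t α))) α ≤ C := by
  rcases hd : P.natDegree with _ | e
  · exact ⟨0, fun α => by simp [dyadicEnergy_multiplier_eq_zero hd]⟩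
  · exact exists_tsum_dyadicEnergy_multiplier_le_of_natDegree hd hδ

end SumOverScales

/-! ### Transfer to the circle -/

section Transfer

open MeasureTheory AddCircle

theorem measurable_circleFract : Measurable circleFract :=
  measurable_subtype_coe.comp (measurableEquivIco (1 : ℝ) 0).measurable

theorem measurableSet_majorArcAt (P : ℤ[X]) (δ : ℝ) (n : ℕ) (r : ℚ) :
    MeasurableSet (majorArcAt P δ n r) := by
  have hsmul : Measurable fun α : UnitAddCircle => P.leadingCoeff • α :=
    (continuous_zsmul P.leadingCoeff).measurable
  refine measurableSet_lt ?_ measurable_const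
  split_ifs
  · exact hsmul.norm
  · exact ((measurable_circleFract.comp hsmul).sub_const _).norm

theorem measurableSet_majorArcs (P : ℤ[X]) (δ : ℝ) (n : ℕ) : MeasurableSet (majorArcs P δ n) :=
  .iUnion fun _ => .iUnion fun _ => .iUnion fun r => .iUnion fun _ =>
    measurableSet_majorArcAt P δ n r

theorem continuous_multiplier (P : ℤ[X]) (t : ℕ) : Continuous (multiplier P t) := by
  unfold multiplier natAvg
  fun_prop

section Parseval

variable {T : ℝ} [Fact (0 < T)]

theorem tsum_enorm_sq_fourierCoeff {g : AddCircle T → ℂ} (hg : MemLp g 2 haarAddCircle) :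
    ∑' i : ℤ, ‖fourierCoeff g i‖ₑ ^ 2 = ∫⁻ α, ‖g α‖ₑ ^ 2 ∂haarAddCircle := by
  have hparseval := hasSum_sq_fourierCoeff hg.toLp
  have hnorm : ∫ α, ‖hg.toLp g α‖ ^ 2 ∂haarAddCircle = ∫ α, ‖g α‖ ^ 2 ∂haarAddCircle :=
    integral_congr_ae (hg.coeFn_toLp.fun_comp fun z => ‖z‖ ^ 2)
  rw [fourierCoeff_congr_ae hg.coeFn_toLp, hnorm] at hparseval
  have henorm (z : ℂ) : ‖z‖ₑ ^ 2 = ENNReal.ofReal (‖z‖ ^ 2) := by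
    rw [ENNReal.ofReal_pow (norm_nonneg _), ofReal_norm]
  simp only [henorm]
  rw [← ENNReal.ofReal_tsum_of_nonneg (fun _ => sq_nonneg _) hparseval.summable,
    hparseval.tsum_eq, ofReal_integral_eq_lintegral_ofReal
      (hg.integrable_norm_pow two_ne_zero) (ae_of_all _ fun _ => sq_nonneg _)]

theorem tsum_enorm_sq_setIntegral_fourier_mul {D : Set (AddCircle T)} (hD : MeasurableSet D)
    {g : AddCircle T → ℂ} (hg : MemLp g 2 haarAddCircle) :
    ∑' x : ℤ, ‖∫ α in D, fourier x α * g α ∂haarAddCircle‖ₑ ^ 2 =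
      ∫⁻ α in D, ‖g α‖ₑ ^ 2 ∂haarAddCircle := by
  have hcoeff (x : ℤ) :
      ∫ α in D, fourier x α * g α ∂haarAddCircle = fourierCoeff (D.indicator g) (-x) := by
    rw [fourierCoeff, neg_neg, ← integral_indicator hD]
    simp only [Set.indicator_mul_right, smul_eq_mul]
  simp only [hcoeff]
  rw [tsum_comp_neg fun i => ‖fourierCoeff (D.indicator g) i‖ₑ ^ 2,
    tsum_enorm_sq_fourierCoeff (hg.indicator hD), ← lintegral_indicator hD]
  refine lintegral_congr fun α => ?_
  by_cases hα : α ∈ D <;> simp [hα]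

end Parseval

theorem fourierCoeff_latticeFourier (f : EllTwo) (i : ℤ) :
    fourierCoeff (latticeFourier f) i = f (-i) := by
  rw [← fourierBasis_repr, HilbertBasis.repr_apply_apply, coe_fourierBasis]
  refine ((hasSum_latticeFourier f).mapL (innerSL ℂ (fourierLp 2 i))).unique ?_
  have hinner := orthonormal_iff_ite.1 (orthonormal_fourier (T := (1 : ℝ))) i
  refine (hasSum_ite_eq (-i) (f (-i))).congr_fun fun m => ?_
  rw [map_smul, innerSL_apply_apply, hinner, smul_eq_mul, mul_ite, mul_one, mul_zero]
  by_cases hm : m = -i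
  · simp [hm]
  · rw [if_neg hm, if_neg fun h => hm (by omega)]

theorem lintegral_enorm_sq_latticeFourier (f : EllTwo) :
    ∫⁻ α, ‖latticeFourier f α‖ₑ ^ 2 ∂haarAddCircle = ellTwoNormSq (fun x => ‖f x‖ₑ) := by
  rw [← tsum_enorm_sq_fourierCoeff (Lp.memLp (latticeFourier f)), ellTwoNormSq,
    ← tsum_comp_neg]
  simp only [fourierCoeff_latticeFourier, neg_neg]

theorem memLp_continuous_mul_latticeFourier {w : UnitAddCircle → ℂ} (hw : Continuous w)
    (f : EllTwo) : MemLp (fun α => w α * latticeFourier f α) 2 haarAddCircle :=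
  (Lp.memLp (latticeFourier f)).mul (BoundedContinuousFunction.mkOfCompact ⟨w, hw⟩).memLp_top

theorem polyMean_eq_natAvg (P : ℤ[X]) (t : ℕ) (g : ℤ → ℂ) (x : ℤ) :
    polyMean P t g x = natAvg (fun m => g (x + P.eval (m : ℤ))) t := by
  rw [polyMean, natAvg, range_eq_Ico, sum_Ico_add' (fun m : ℕ => g (x + P.eval (m : ℤ))) 0 t 1,
    zero_add, Complex.real_smul, one_div, Complex.ofReal_inv, Complex.ofReal_natCast]
  rfl

theorem polyMean_freqProj (P : ℤ[X]) (D : Set UnitAddCircle) (f : EllTwo) (t : ℕ) (x : ℤ) :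
    polyMean P t (freqProj D f) x =
      ∫ α in D, fourier x α * (multiplier P t α * latticeFourier f α) ∂haarAddCircle := by
  have hint (k : ℤ) :
      IntegrableOn (fun α => fourier k α * latticeFourier f α) D haarAddCircle :=
    ((memLp_continuous_mul_latticeFourier (map_continuous (fourier k)) f).integrable
      one_le_two).integrableOn
  rw [polyMean_eq_natAvg, natAvg]
  simp only [freqProj]
  rw [← integral_finsetSum _ fun _ _ => hint _, ← integral_smul]
  congr 1
  funext α
  simp only [multiplier, natAvg, fourier_add, mul_assoc, ← mul_sum, ← sum_mul, mul_smul_comm,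
    smul_mul_assoc]

theorem tsum_enorm_sq_polyMean_sub (P : ℤ[X]) {D : Set UnitAddCircle} (hD : MeasurableSet D)
    (f : EllTwo) (t t' : ℕ) :
    ∑' x : ℤ, ‖polyMean P t (freqProj D f) x - polyMean P t' (freqProj D f) x‖ₑ ^ 2 =
      ∫⁻ α in D, ‖multiplier P t α * latticeFourier f α -
        multiplier P t' α * latticeFourier f α‖ₑ ^ 2 ∂haarAddCircle := by
  have hmem (t : ℕ) := memLp_continuous_mul_latticeFourier (continuous_multiplier P t) f
  have hint (x : ℤ) (t : ℕ) : IntegrableOn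
      (fun α => fourier x α * (multiplier P t α * latticeFourier f α)) D haarAddCircle := by
    simp only [← mul_assoc]
    exact ((memLp_continuous_mul_latticeFourier ((map_continuous (fourier x)).mul
      (continuous_multiplier P t)) f).integrable one_le_two).integrableOn
  refine Eq.trans ?_ (tsum_enorm_sq_setIntegral_fourier_mul hD ((hmem t).sub (hmem t')))
  simp only [polyMean_freqProj, ← integral_sub (hint _ _) (hint _ _), mul_sub]

section LIntegral

variable {X Y E : Type*} [MeasurableSpace X] [MeasurableSpace Y] [SeminormedAddCommGroup E]
  {μ : Measure X} {ν : Measure Y}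

theorem lintegral_ofReal_dyadicEnergy {a : X → ℕ → E}
    (ha : ∀ t, AEStronglyMeasurable (fun x => a x t) μ) (n : ℕ) :
    ∫⁻ x, ENNReal.ofReal (dyadicEnergy n (a x)) ∂μ =
      ∑ l ∈ range (n + 1), ENNReal.ofReal ((6 / 5) ^ l) *
        ∑ j ∈ range (2 ^ l + 1), ∫⁻ x, ‖dyadicIncrement n (a x) l j‖ₑ ^ 2 ∂μ := by
  have hmeas (l j : ℕ) : AEMeasurable (fun x => ‖dyadicIncrement n (a x) l j‖ₑ ^ 2) μ :=
    ((ha _).sub (ha _)).enorm.pow_const 2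
  have hexpand (x : X) : ENNReal.ofReal (dyadicEnergy n (a x)) =
      ∑ l ∈ range (n + 1), ENNReal.ofReal ((6 / 5) ^ l) *
        ∑ j ∈ range (2 ^ l + 1), ‖dyadicIncrement n (a x) l j‖ₑ ^ 2 := by
    rw [dyadicEnergy, ENNReal.ofReal_sum_of_nonneg fun _ _ => by positivity]
    refine sum_congr rfl fun l _ => ?_
    rw [ENNReal.ofReal_mul (by positivity), ENNReal.ofReal_sum_of_nonneg fun _ _ => by positivity]
    simp only [ENNReal.ofReal_pow (norm_nonneg _), ofReal_norm]
  simp only [hexpand]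
  rw [lintegral_finsetSum' _ fun l _ =>
    (Finset.aemeasurable_fun_sum _ fun j _ => hmeas l j).const_mul _]
  refine sum_congr rfl fun l _ => ?_
  rw [lintegral_const_mul' _ _ ENNReal.ofReal_ne_top,
    lintegral_finsetSum' _ fun j _ => hmeas l j]

theorem lintegral_ofReal_dyadicEnergy_congr {a : X → ℕ → E} {b : Y → ℕ → E}
    (ha : ∀ t, AEStronglyMeasurable (fun x => a x t) μ)
    (hb : ∀ t, AEStronglyMeasurable (fun y => b y t) ν)
    (hab : ∀ t t', ∫⁻ x, ‖a x t - a x t'‖ₑ ^ 2 ∂μ = ∫⁻ y, ‖b y t - b y t'‖ₑ ^ 2 ∂ν) (n : ℕ) :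
    ∫⁻ x, ENNReal.ofReal (dyadicEnergy n (a x)) ∂μ =
      ∫⁻ y, ENNReal.ofReal (dyadicEnergy n (b y)) ∂ν := by
  simp only [lintegral_ofReal_dyadicEnergy ha, lintegral_ofReal_dyadicEnergy hb, dyadicIncrement,
    hab]

end LIntegral

theorem tsum_ofReal_dyadicEnergy_polyMean (P : ℤ[X]) {D : Set UnitAddCircle}
    (hD : MeasurableSet D) (f : EllTwo) (n : ℕ) :
    ∑' x : ℤ, ENNReal.ofReal (dyadicEnergy n fun t => polyMean P t (freqProj D f) x) =
      ∫⁻ α in D, ENNReal.ofReal (dyadicEnergy n fun t => multiplier P t α) *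
        ‖latticeFourier f α‖ₑ ^ 2 ∂haarAddCircle := by
  have hsmul (α : UnitAddCircle) :
      ENNReal.ofReal (dyadicEnergy n fun t => multiplier P t α) * ‖latticeFourier f α‖ₑ ^ 2 =
        ENNReal.ofReal (dyadicEnergy n fun t => multiplier P t α * latticeFourier f α) := by
    simp only [mul_comm _ (latticeFourier f α), ← smul_eq_mul (latticeFourier f α),
      dyadicEnergy_smul]
    rw [ENNReal.ofReal_mul (sq_nonneg _), ENNReal.ofReal_pow (norm_nonneg _), ofReal_norm, mul_comm]
  simp only [hsmul]
  rw [← lintegral_count]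
  refine lintegral_ofReal_dyadicEnergy_congr
    (a := fun x t => polyMean P t (freqProj D f) x)
    (b := fun α t => multiplier P t α * latticeFourier f α)
    (fun _ => .of_discrete) (fun t => ?_) (fun t t' => ?_) n
  · exact (memLp_continuous_mul_latticeFourier (continuous_multiplier P t) f).1.restrict
  · rw [lintegral_count, tsum_enorm_sq_polyMean_sub P hD]

theorem ellTwoNormSq_shortVariation_le (P : ℤ[X]) {D : Set UnitAddCircle} (hD : MeasurableSet D)
    (f : EllTwo) (n : ℕ) :
    ellTwoNormSq (shortVariation P n (freqProj D f)) ≤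
      24 * ∫⁻ α, D.indicator
        (fun α => ENNReal.ofReal (dyadicEnergy n fun t => multiplier P t α)) α *
          ‖latticeFourier f α‖ₑ ^ 2 ∂haarAddCircle := by
  simp only [← Set.indicator_mul_left D _ fun α => ‖latticeFourier f α‖ₑ ^ 2]
  rw [lintegral_indicator hD, ← tsum_ofReal_dyadicEnergy_polyMean P hD, ← ENNReal.tsum_mul_left]
  refine ENNReal.tsum_le_tsum fun x => (variation_two_sq_le_dyadicEnergy n _).trans_eq ?_
  rw [ENNReal.ofReal_mul (by norm_num), ENNReal.ofReal_ofNat]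

theorem measurable_dyadicEnergy_multiplier (P : ℤ[X]) (n : ℕ) :
    Measurable fun α => dyadicEnergy n fun t => multiplier P t α := by
  have := continuous_multiplier P
  unfold dyadicEnergy dyadicIncrement
  fun_prop

end Transfer

end PolyVariation

open PolyVariation MeasureTheory AddCircle in
theorem mainTheorem7_general (P : ℤ[X]) {δ : ℝ} (hδ : δ < 1 / 10) :
    ∃ C : ℝ≥0, ∀ f : EllTwo,
      ∑' n : ℕ, ellTwoNormSq (shortVariation P n (freqProj (majorArcs P δ n) f)) ≤
        (C : ℝ≥0∞) * ellTwoNormSq (fun x => ‖f x‖ₑ) := by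
  obtain ⟨C, hC⟩ := exists_tsum_dyadicEnergy_multiplier_le P hδ
  refine ⟨24 * C, fun f => ?_⟩
  let S (n : ℕ) : UnitAddCircle → ℝ≥0∞ := (majorArcs P δ n).indicator fun α =>
    ENNReal.ofReal (dyadicEnergy n fun t => multiplier P t α)
  have hS (n : ℕ) : Measurable (S n) :=
    (measurable_dyadicEnergy_multiplier P n).ennreal_ofReal.indicator
      (measurableSet_majorArcs P δ n)
  have hf : AEMeasurable (fun α => ‖latticeFourier f α‖ₑ ^ 2) haarAddCircle :=
    (Lp.aestronglyMeasurable _).enorm.pow_const 2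
  calc _ ≤ ∑' n, 24 * ∫⁻ α, S n α * ‖latticeFourier f α‖ₑ ^ 2 ∂haarAddCircle :=
        ENNReal.tsum_le_tsum fun n =>
          ellTwoNormSq_shortVariation_le P (measurableSet_majorArcs P δ n) f n
    _ = 24 * ∫⁻ α, (∑' n, S n α) * ‖latticeFourier f α‖ₑ ^ 2 ∂haarAddCircle := by
        simp only [ENNReal.tsum_mul_left, ← ENNReal.tsum_mul_right]
        rw [lintegral_tsum fun n => (hS n).aemeasurable.fun_mul hf]
    _ ≤ 24 * ∫⁻ α, C * ‖latticeFourier f α‖ₑ ^ 2 ∂haarAddCircle := by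
        gcongr with α
        exact hC α
    _ = _ := by
        rw [lintegral_const_mul' _ _ ENNReal.coe_ne_top, lintegral_enorm_sq_latticeFourier,
          ← mul_assoc, ENNReal.coe_mul, ENNReal.coe_ofNat]

theorem mainTheorem7 :
    ∃ δ₀ : ℝ, 0 < δ₀ ∧
      ∀ P : ℤ[X], 0 < P.leadingCoeff →
        ∀ δ : ℝ, 0 < δ → δ < δ₀ →
          ∃ C : ℝ≥0, ∀ f : PolyVariation.EllTwo,
            ∑' n : ℕ, PolyVariation.ellTwoNormSq
                (PolyVariation.shortVariation P n
                  (PolyVariation.freqProj (PolyVariation.majorArcs P δ n) f))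
              ≤ (C : ℝ≥0∞) * PolyVariation.ellTwoNormSq (fun x => ‖f x‖ₑ) :=
  ⟨1 / 10, by norm_num, fun P _ _ _ hδ => mainTheorem7_general P hδ⟩
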